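/- Let $\lambda_1,\lambda_2,\lambda_3>0$, let $\mathbb T_i=\mathbb R/\lambda_i\mathbb Z$, $\mathbb T^3=\mathbb T_1\times\mathbb T_2\times\mathbb T_3$, and let $d_1,d_2,d_3\in\mathbb R$. Put $$e^{(1)}=\begin{pmatrix} d_1&1&1\\1&d_2&1\\1&1&d_3\end{pmatrix},\ e^{(2)}=\begin{pmatrix} d_1&-1&-1\\-1&d_2&1\\-1&1&d_3\end{pmatrix},\ e^{(3)}=\begin{pmatrix} d_1&1&-1\\1&d_2&-1\\-1&-1&d_3\end{pmatrix},\ e^{(4)}=\begin{pmatrix} d_1&-1&1\\-1&d_2&-1\\1&-1&d_3\end{pmatrix}.$$ Let $u\in W^{1,1}_{loc}(\mathbb R^3;\mathbb R^3)$ be a displacement whose symmetrized gradient $e(u)=\frac12(\nabla u+(\nabla u)^t)$ is $\lambda_i$-periodic in $x_i$ for $i=1,2,3$ (so that $e(u)$ is a field on $\mathbb T^3$; $u$ itself need not be periodic), and suppose that $e(u)(x)\in\{e^{(1)},e^{(2)},e^{(3)},e^{(4)}\}$ for a.e. $x$. Then: (i) There is $j\in\{1,2,3\}$ such that $\partial_j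 e(u)=0$ in the sense of distributions. (ii) If $\partial_2 e(u)=0$, then there are measurable functions $f_1:\mathbb T_1\to\{-1,1\}$ and $f_3:\mathbb T_3\to\{-1,1\}$ such that either $e_{13}(u)(x)=f_1(x_1)$ for a.e. $x$, or $e_{13}(u)(x)=f_3(x_3)$ for a.e. $x$. (iii) If $\partial_2 e(u)=0$ and $e_{13}(u)(x)=f_3(x_3)$ for a.e. $x$, where $f_3:\mathbb T_3\to\{-1,1\}$ is measurable, let $F_3(s)=\int_0^s f_3(r)\,dr$ (that is, $F_3'=f_3$ a.e. and $F_3(0)=0$) and $\Phi(s,t)=(t-F_3(s),s)$, a map into the $(x_1,x_3)$-plane. Then there is $g:\mathbb R\to\mathbb R$ such that $$(e_{12}(u)\circ\Phi)(s,t)=g(t),\qquad (e_{23}(u)\circ\Phi)(s,t)=f_3(s)\,g(t)$$ for a.e. $(s,t)\in\mathbb R^2$ (and a.e. value of $x_2$, on which $e(u)$ does not depend). -/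

import Mathlib

open MeasureTheory
open scoped ContDiff Matrix

namespace CubicTrigonal

/-- Points of three-dimensional space. The coordinates `x₁, x₂, x₃` are `x 0, x 1, x 2`. -/
abbrev Space : Type := Fin 3 → ℝ

/-- `g` is the weak (distributional) partial derivative `∂ⱼ f` of `f` on all of space,
both functions being locally integrable. -/
def HasWeakPartial (j : Fin 3) (f g : Space → ℝ) : Prop :=
  LocallyIntegrable f ∧ LocallyIntegrable g ∧
    ∀ φ : Space → ℝ, ContDiff ℝ ∞ φ → HasCompactSupport φ →
      ∫ x, f x * fderiv ℝ φ x (Pi.single j 1) = -∫ x, g x * φ x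

/-- `u` is in `W^{1,1}_loc` and `G` is its weak gradient, `G x i j = ∂ⱼ uᵢ (x)`. -/
def HasWeakGradient (u : Space → Space) (G : Space → Matrix (Fin 3) (Fin 3) ℝ) : Prop :=
  ∀ i j : Fin 3, HasWeakPartial j (fun x => u x i) (fun x => G x i j)

/-- The symmetrized gradient `e(u) = (∇u + (∇u)ᵗ) / 2`, where `G = ∇u`. -/
noncomputable def symGrad (G : Space → Matrix (Fin 3) (Fin 3) ℝ) (x : Space) :
    Matrix (Fin 3) (Fin 3) ℝ :=
  (1 / 2 : ℝ) • (G x + (G x)ᵀ)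

/-- The four cubic-to-trigonal strains `e⁽¹⁾, …, e⁽⁴⁾` with material constants
`d₁, d₂, d₃`. -/
def wells (d : Fin 3 → ℝ) : Set (Matrix (Fin 3) (Fin 3) ℝ) :=
  {!![d 0, 1, 1; 1, d 1, 1; 1, 1, d 2],
   !![d 0, -1, -1; -1, d 1, 1; -1, 1, d 2],
   !![d 0, 1, -1; 1, d 1, -1; -1, -1, d 2],
   !![d 0, -1, 1; -1, d 1, -1; 1, -1, d 2]}

/-- `e` is periodic (up to null sets) with respect to the lattice `ℓ₁ℤ × ℓ₂ℤ × ℓ₃ℤ`, i.e. it is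
(the lift of) a field on the torus `[0, ℓ₁) × [0, ℓ₂) × [0, ℓ₃)`. -/
def IsTorusPeriodic (ℓ : Fin 3 → ℝ) (e : Space → Matrix (Fin 3) (Fin 3) ℝ) : Prop :=
  ∀ i : Fin 3, ∀ᵐ x : Space, e (x + Pi.single i (ℓ i)) = e x

/-- `∂ⱼ e = 0` in the sense of distributions, for every entry of the matrix field `e`. -/
def PartialEqZero (j : Fin 3) (e : Space → Matrix (Fin 3) (Fin 3) ℝ) : Prop :=
  ∀ a b : Fin 3, HasWeakPartial j (fun x => e x a b) (fun _ => 0)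

/-- `f` is (the lift of) a measurable function on the circle `[0, p)` with values in `{-1, 1}`. -/
def IsSignProfile (p : ℝ) (f : ℝ → ℝ) : Prop :=
  Measurable f ∧ Function.Periodic f p ∧ ∀ t, f t ∈ ({-1, 1} : Set ℝ)

/-- The absolutely continuous function `F` with `F' = f` almost everywhere and `F 0 = 0`. -/
noncomputable def primitive (f : ℝ → ℝ) (s : ℝ) : ℝ := ∫ r in (0 : ℝ)..s, f r

/-- The shear `Φ(s, t) = (t - F(s), s)`, with values in the `(x₁, x₃)`-plane. -/
def shear (F : ℝ → ℝ) (p : ℝ × ℝ) : ℝ × ℝ := (p.2 - F p.1, p.1)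

/-- The point of space with `(x₁, x₃) = q` and `x₂ = y`. -/
def liftPoint (q : ℝ × ℝ) (y : ℝ) : Space := ![q.1, y, q.2]

end CubicTrigonal

open CubicTrigonal

namespace CubicTrigonal

open Set Filter Topology
open scoped NNReal

/-! ### Periodic Lipschitz functions of one variable. -/

section OneVariable

variable {F H : ℝ → ℝ} {C D : ℝ≥0}

/-! The diagonal of e(u) is constant, and its other entries are signs with e₁₂ e₂₃ = e₁₃.
`exists_potential` turns this into e_ij = m_ij + ∂_j φ_i + ∂_i φ_j for i ≠ j, where each φ_i is
Lipschitz, periodic and independent of x_i. In a plane spanned by e_i and e_j the entry e_ij is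
therefore a function of x_j plus a function of x_i. Such a sum takes only two values only if one
summand is trivial: on almost every such plane φ_i is constant in x_j or φ_j is constant in x_i
(`const_or_const`).

A priori the alternative varies with the third coordinate. `trichotomy` limits this: φ_i is
constant, or in one of its two directions almost no line sees it constant. The product relation then
restricts the remaining patterns. Cyclic dependence is impossible (`not_cyclic`). When φ_j is
constant, the relation is a transport equation for φ_i, and energy uniqueness spreads constancy from
one line in direction e_k to all of them (`constLine_of_transport`). In every surviving pattern some
coordinate enters no φ_n, which is (i).

For (ii), the planar alternative is applied on one well-chosen slice. For (iii), φ₁ and φ₃ do not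
depend on x₂, and e₂₃ = f₃ e₁₂ becomes a transport equation for φ₂ with characteristics x₁ + F₃(x₃)
= const. Comparing φ₂ with the explicit solution through `eq_zero_of_transport` gives g. -/

theorem absCont_of_lipschitz (hF : LipschitzWith C F) (a b : ℝ) :
    AbsolutelyContinuousOnInterval F a b :=
  (hF.lipschitzOnWith (s := uIcc a b)).absolutelyContinuousOnInterval

theorem integral_deriv_of_lipschitz (hF : LipschitzWith C F) (a b : ℝ) :
    ∫ s in a..b, deriv F s = F b - F a :=
  (absCont_of_lipschitz hF a b).integral_deriv_eq_sub

theorem monotone_of_deriv_ae_nonneg (hF : LipschitzWith C F) (h : ∀ᵐ s, 0 ≤ deriv F s) :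
    Monotone F := by
  intro a b hab
  have h1 := integral_deriv_of_lipschitz hF a b
  have h2 : 0 ≤ ∫ s in a..b, deriv F s :=
    intervalIntegral.integral_nonneg_of_ae hab h
  linarith

theorem const_of_monotone_periodic {p : ℝ} (hp : 0 < p) (hm : Monotone F)
    (hper : Function.Periodic F p) (a b : ℝ) : F a = F b := by
  have key : ∀ a b, F b ≤ F a := by
    intro a b
    obtain ⟨n, hn⟩ := exists_nat_gt ((b - a) / p)
    have h1 : b ≤ a + n * p := by
      rw [div_lt_iff₀ hp] at hn
      linarith
    calc F b ≤ F (a + n * p) := hm h1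
      _ = F a := hper.nat_mul n a
  exact le_antisymm (key b a) (key a b)

theorem const_of_deriv_ae_nonneg {p : ℝ} (hp : 0 < p) (hF : LipschitzWith C F)
    (hper : Function.Periodic F p) (h : ∀ᵐ s, 0 ≤ deriv F s) (a b : ℝ) : F a = F b :=
  const_of_monotone_periodic hp (monotone_of_deriv_ae_nonneg hF h) hper a b

theorem const_of_deriv_ae_nonpos {p : ℝ} (hp : 0 < p) (hF : LipschitzWith C F)
    (hper : Function.Periodic F p) (h : ∀ᵐ s, deriv F s ≤ 0) (a b : ℝ) : F a = F b := by
  have h1 : LipschitzWith C (-F) := hF.neg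
  have h2 : Function.Periodic (-F) p := fun x => by simp [hper x]
  have h3 : ∀ᵐ s, 0 ≤ deriv (-F) s := by
    filter_upwards [h] with s hs
    rw [deriv.neg']
    linarith
  have := const_of_deriv_ae_nonneg hp h1 h2 h3 a b
  simpa using this

theorem const_of_deriv_ae_eq {p c : ℝ} (hp : 0 < p) (hF : LipschitzWith C F)
    (hper : Function.Periodic F p) (h : ∀ᵐ s, deriv F s = c) (a b : ℝ) : F a = F b := by
  rcases le_total 0 c with hc | hc
  · exact const_of_deriv_ae_nonneg hp hF hper (h.mono fun s hs => hs ▸ hc) a b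
  · exact const_of_deriv_ae_nonpos hp hF hper (h.mono fun s hs => hs ▸ hc) a b

/-- If `m + F'(s) + H'(t)` takes only the values `1` and `-1`, then `F` or `H` is constant. -/
theorem const_or_const {p q m : ℝ} (hp : 0 < p) (hq : 0 < q)
    (hF : LipschitzWith C F) (hH : LipschitzWith D H)
    (hFp : Function.Periodic F p) (hHp : Function.Periodic H q)
    (h : ∀ᵐ t, ∀ᵐ s, m + deriv F s + deriv H t = 1 ∨ m + deriv F s + deriv H t = -1) :
    (∀ a b, F a = F b) ∨ (∀ a b, H a = H b) := by
  by_contra! hcon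
  obtain ⟨⟨a, b, hab⟩, c, d, hcd⟩ := hcon
  obtain ⟨t₀, h₀⟩ := h.exists
  -- H' must equal H'(t₀) almost everywhere. Otherwise the two-point sets allowed for F' by t and by
  -- t₀ are different translates of {-1, 1} and share at most one value; then F' is a.e. constant,
  -- and the periodic F is constant.
  refine hcd (const_of_deriv_ae_eq (c := deriv H t₀) hq hH hHp ?_ c d)
  filter_upwards [h] with t ht
  by_contra hne
  refine hab ?_
  rcases lt_or_gt_of_ne hne with hlt | hlt
  · refine const_of_deriv_ae_eq (c := -1 - m - deriv H t) hp hF hFp ?_ a b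
    filter_upwards [ht, h₀] with s hs hs0
    rcases hs with hs | hs <;> rcases hs0 with hs0 | hs0 <;> linarith
  · refine const_of_deriv_ae_eq (c := 1 - m - deriv H t) hp hF hFp ?_ a b
    filter_upwards [ht, h₀] with s hs hs0
    rcases hs with hs | hs <;> rcases hs0 with hs0 | hs0 <;> linarith

/-- If H is the constant one, F' lies in {1 - m, -1 - m}. For m = ±1 this set has one sign, so
periodicity makes F constant; for other m it omits 0. -/
theorem const_or_deriv_ne_zero {p q m : ℝ} (hp : 0 < p) (hq : 0 < q)
    (hF : LipschitzWith C F) (hH : LipschitzWith D H)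
    (hFp : Function.Periodic F p) (hHp : Function.Periodic H q)
    (h : ∀ᵐ t, ∀ᵐ s, m + deriv F s + deriv H t = 1 ∨ m + deriv F s + deriv H t = -1) :
    (∀ a b, F a = F b) ∨ ∀ᵐ s, deriv F s ≠ 0 := by
  rcases const_or_const hp hq hF hH hFp hHp h with h1 | h1
  · exact Or.inl h1
  have h2 : ∀ t, deriv H t = 0 := by
    have : H = fun _ => H 0 := funext fun t => h1 t 0
    intro t
    rw [this]
    simp
  obtain ⟨t₀, h₀⟩ := h.exists
  simp only [h2, add_zero] at h₀
  by_cases hm : m = 1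
  · left
    refine const_of_deriv_ae_nonpos hp hF hFp ?_
    filter_upwards [h₀] with s hs
    rcases hs with hs | hs <;> linarith
  by_cases hm' : m = -1
  · left
    refine const_of_deriv_ae_nonneg hp hF hFp ?_
    filter_upwards [h₀] with s hs
    rcases hs with hs | hs <;> linarith
  right
  filter_upwards [h₀] with s hs h0
  rw [h0, add_zero] at hs
  tauto

/-- Only countably many points of S are isolated in S from the right. At the others the derivative,
where it exists, is a limit of slopes between points of S, all of them zero. -/
theorem ae_deriv_eq_zero_of_level {k : ℝ} (hF : LipschitzWith C F) (S : Set ℝ)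
    (hS : ∀ s ∈ S, F s = k) : ∀ᵐ s, s ∈ S → deriv F s = 0 := by
  have h1 : ∀ᵐ s, s ∉ {x ∈ S | 𝓝[S ∩ Ioi x] x = ⊥} :=
    (countable_setOfPred_isolated_right_within (s := S)).ae_notMem _
  filter_upwards [h1, hF.ae_differentiableAt_real] with s hs hd hsS
  have hne : (𝓝[S ∩ Ioi s] s).NeBot := by
    rw [neBot_iff]
    intro hbot
    exact hs ⟨hsS, hbot⟩
  have hT := hasDerivAt_iff_tendsto_slope.1 hd.hasDerivAt
  have hsub : S ∩ Ioi s ⊆ {s}ᶜ := fun y hy => by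
    have := hy.2
    simp only [mem_Ioi] at this
    simp [this.ne']
  have hT' := hT.mono_left (nhdsWithin_mono s hsub)
  refine tendsto_nhds_unique (hT'.congr' ?_) tendsto_const_nhds
  filter_upwards [self_mem_nhdsWithin] with y hy
  simp [slope_def_field, hS y hy.1, hS s hsS]

end OneVariable

/-! ### Energy uniqueness for the transport equation. -/

section Energy

theorem eq_zero_of_integral_sq {f : ℝ → ℝ} (hf : Continuous f) {a b : ℝ} (hab : a < b)
    (h : ∫ z in a..b, f z ^ 2 = 0) : f a = 0 := by
  by_contra hne
  have := intervalIntegral.integral_pos hab (f := fun z => f z ^ 2) (by fun_prop)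
    (fun z _ => sq_nonneg _) ⟨a, left_mem_Icc.2 hab.le, by positivity⟩
  linarith

/-- Uniqueness for the transport equation `∂_y w = b(y) ∂_z w` with periodicity in `z`. -/
theorem eq_zero_of_transport {w : ℝ → ℝ → ℝ} {C D : ℝ≥0} {p y₀ : ℝ} (hp : 0 < p)
    (hw : Continuous (Function.uncurry w))
    (hy : ∀ z, LipschitzWith C (fun y => w y z)) (hz : ∀ y, LipschitzWith D (w y))
    (hper : ∀ y, Function.Periodic (w y) p)
    (heq : ∀ᵐ y, ∃ b : ℝ, ∀ᵐ z, deriv (fun y' => w y' z) y = b * deriv (w y) z)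
    (h0 : ∀ z, w y₀ z = 0) (y z : ℝ) : w y z = 0 := by
  have hmeas : Measurable fun q : ℝ × ℝ => deriv (fun y' => w y' q.2) q.1 := by
    have hc : Continuous (Function.uncurry fun z y => w y z) := hw.comp continuous_swap
    have h1 := measurable_deriv_with_param hc
    exact h1.comp measurable_swap
  have hwz : ∀ y, Continuous (w y) := fun y => (hz y).continuous
  refine eq_zero_of_integral_sq (hwz y) (show z < z + p by linarith) ?_
  -- After integration over a period in z and an exchange of integrals, the inner integrand is b
  -- ∂_z(w²), whose integral over a period vanishes.
  have key : ∀ z, w y z ^ 2 = ∫ y' in y₀..y, deriv (fun y'' => w y'' z) y' * (2 * w y' z) := by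
    intro z
    have h1 := (absCont_of_lipschitz (hy z) y₀ y).integral_deriv_mul_eq_sub
      (absCont_of_lipschitz (hy z) y₀ y)
    simp only [h0 z, mul_zero, sub_zero] at h1
    rw [sq, ← h1]
    congr 1
    ext y'
    ring
  simp_rw [key]
  rw [intervalIntegral.integral_of_le (by linarith)]
  rw [← intervalIntegral_integral_swap (f := fun y' z => deriv (fun y'' => w y'' z) y' * (2 * w y' z))]
  · have hzero : ∀ᵐ y' : ℝ, ∫ z in Ioc z (z + p), deriv (fun y'' => w y'' z) y' * (2 * w y' z) = 0 := by
      filter_upwards [heq] with y' hy'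
      obtain ⟨b, hb⟩ := hy'
      rw [← intervalIntegral.integral_of_le (by linarith)]
      have h1 := (absCont_of_lipschitz (hz y') z (z + p)).integral_deriv_mul_eq_sub
        (absCont_of_lipschitz (hz y') z (z + p))
      rw [hper y' z, sub_self] at h1
      rw [intervalIntegral.integral_congr_ae (g := fun z => b * (deriv (w y') z * w y' z + w y' z * deriv (w y') z)),
        intervalIntegral.integral_const_mul, h1, mul_zero]
      filter_upwards [hb] with z' hz' _
      rw [hz']
      ring
    rw [intervalIntegral.integral_congr_ae (g := fun _ => (0 : ℝ))
      (by filter_upwards [hzero] with s hs _ using hs)]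
    simp
  · have hbd : ∀ᵐ q ∂((volume.restrict (uIoc y₀ y)).prod (volume.restrict (Ioc z (z + p)))),
        ‖deriv (fun y'' => w y'' q.2) q.1 * (2 * w q.1 q.2)‖ ≤ C * (2 * (C * |y - y₀|)) := by
      rw [Measure.prod_restrict]
      refine (ae_restrict_iff' (measurableSet_uIoc.prod measurableSet_Ioc)).2 (Eventually.of_forall ?_)
      rintro ⟨y', z'⟩ ⟨hy', -⟩
      rw [norm_mul, norm_mul]
      have h1 : ‖w y' z'‖ ≤ C * |y - y₀| := by
        have h2 := (hy z').norm_sub_le y' y₀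
        simp only [h0, sub_zero] at h2
        refine h2.trans (mul_le_mul_of_nonneg_left ?_ C.2)
        exact abs_sub_left_of_mem_uIcc (uIoc_subset_uIcc hy')
      have h3 : ‖deriv (fun y'' => w y'' z') y'‖ ≤ C := norm_deriv_le_of_lipschitz (hy z')
      simp only [Real.norm_ofNat]
      gcongr
    have : IsFiniteMeasure (volume.restrict (uIoc y₀ y)) := ⟨by simp [uIoc]⟩
    refine Integrable.of_bound ?_ _ hbd
    exact (hmeas.mul (hw.measurable.const_mul 2)).aestronglyMeasurable

end Energy

/-! ### Restriction to lines and transport in space. -/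

/-- For each fixed s, translation by s • v preserves null sets; Fubini exchanges the quantifiers
once the exceptional set is enlarged to a measurable one. -/
theorem ae_ae_line {Q : Space → Prop} (h : ∀ᵐ x, Q x) (v : Space) :
    ∀ᵐ x, ∀ᵐ s : ℝ, Q (x + s • v) := by
  set T : Set Space := (toMeasurable volume {x | ¬ Q x})ᶜ with hT
  have hTm : MeasurableSet T := (measurableSet_toMeasurable _ _).compl
  have hTQ : ∀ x ∈ T, Q x := fun x hx => by
    by_contra hq
    exact hx (subset_toMeasurable _ _ hq)
  have hT0 : ∀ᵐ x, x ∈ T := by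
    rw [ae_iff]
    simp only [hT, mem_compl_iff, not_not, ofPred_mem_eq, measure_toMeasurable]
    exact ae_iff.1 h
  have key : ∀ᵐ x, ∀ᵐ s : ℝ, x + s • v ∈ T := by
    rw [Measure.ae_ae_comm]
    · exact Eventually.of_forall fun s =>
        (measurePreserving_add_right volume (s • v)).quasiMeasurePreserving.ae hT0
    · exact (by fun_prop : Measurable fun q : Space × ℝ => q.1 + q.2 • v) hTm
  filter_upwards [key] with x hx
  filter_upwards [hx] with s hs using hTQ _ hs

/-- The coordinate direction `eⱼ`. -/
abbrev unitVec (j : Fin 3) : Space := Pi.single j 1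

theorem norm_unitVec (j : Fin 3) : ‖unitVec j‖ = 1 := by
  rw [unitVec, Pi.norm_single, norm_one]

theorem eq_add_shifts {i j k : Fin 3} (hij : i ≠ j) (hjk : j ≠ k) (hik : i ≠ k) (x y : Space) :
    y = x + (y i - x i) • unitVec i + (y j - x j) • unitVec j + (y k - x k) • unitVec k := by
  ext l
  have hl : l = i ∨ l = j ∨ l = k := by
    revert i j k l
    decide
  rcases hl with rfl | rfl | rfl <;>
    simp [unitVec, hij, hjk, hik, hij.symm, hjk.symm, hik.symm]

theorem forall_of_ae_of_isClosed {Q : Space → Prop} (hc : IsClosed {x | Q x}) (h : ∀ᵐ x, Q x)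
    (x : Space) : Q x := by
  have h1 : Dense {x | Q x} := Measure.dense_of_ae h
  have h2 : closure {x | Q x} = {x | Q x} := hc.closure_eq
  have h3 := h1 x
  rwa [h2] at h3

theorem lipschitz_line {f : Space → ℝ} {C : ℝ≥0} (hf : LipschitzWith C f) (x : Space) (j : Fin 3) :
    LipschitzWith C fun s : ℝ => f (x + s • unitVec j) := by
  refine LipschitzWith.of_dist_le_mul fun s t => ?_
  refine (hf.dist_le_mul _ _).trans (le_of_eq ?_)
  congr 1
  rw [dist_add_left, dist_eq_norm, ← sub_smul, norm_smul, norm_unitVec, mul_one, Real.dist_eq,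
    Real.norm_eq_abs]

theorem deriv_line (f : Space → ℝ) (x v : Space) (s : ℝ) :
    deriv (fun t : ℝ => f (x + t • v)) s = lineDeriv ℝ f (x + s • v) v := by
  unfold lineDeriv
  have h := deriv_comp_const_add (f := fun t : ℝ => f (x + t • v)) s 0
  simp only [add_zero] at h
  rw [← h]
  congr 1
  ext t
  rw [add_smul, add_assoc]

theorem hasDerivAt_line {f : Space → ℝ} {x v : Space} {s : ℝ}
    (h : LineDifferentiableAt ℝ f (x + s • v) v) :
    HasDerivAt (fun t : ℝ => f (x + t • v)) (lineDeriv ℝ f (x + s • v) v) s := by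
  have h1 : HasDerivAt (fun t : ℝ => f (x + s • v + t • v)) (lineDeriv ℝ f (x + s • v) v)
      (s - s) := by
    rw [sub_self]
    exact h.hasLineDerivAt
  refine (h1.comp_sub_const s s).congr_of_eventuallyEq (Eventually.of_forall fun t => ?_)
  simp only
  congr 1
  module

theorem lineDeriv_shift {f : Space → ℝ} {w : Space} (h : ∀ x, f (x + w) = f x) (x v : Space) :
    lineDeriv ℝ f (x + w) v = lineDeriv ℝ f x v := by
  unfold lineDeriv
  congr 1
  ext t
  rw [add_right_comm, h]

theorem lineDeriv_eq_zero {f : Space → ℝ} {v x : Space} (h : ∀ s : ℝ, f (x + s • v) = f x) :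
    lineDeriv ℝ f x v = 0 := by
  unfold lineDeriv
  simp [h]

/-- If a Lipschitz function solves a transport equation `∂ⱼ f = b(xⱼ) ∂ₖ f + c(xⱼ)` and is constant
in direction `eₖ` along one line, it is constant in direction `eₖ`. -/
theorem const_line_of_transport {f : Space → ℝ} {C : ℝ≥0} {p : ℝ} (hp : 0 < p)
    (hf : LipschitzWith C f) {i j k : Fin 3} (hij : i ≠ j) (hjk : j ≠ k) (hik : i ≠ k)
    (hinv : ∀ x (s : ℝ), f (x + s • unitVec i) = f x)
    (hper : ∀ x, f (x + p • unitVec k) = f x)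
    (heq : ∀ᵐ x, ∃ b c : ℝ, ∀ᵐ s : ℝ, lineDeriv ℝ f (x + s • unitVec k) (unitVec j) =
      b * lineDeriv ℝ f (x + s • unitVec k) (unitVec k) + c)
    {y₀ : Space} (hy₀ : ∀ s : ℝ, f (y₀ + s • unitVec k) = f y₀) (x : Space) (τ : ℝ) :
    f (x + τ • unitVec k) = f x := by
  have hd : ∀ᵐ x, ∀ᵐ s : ℝ, LineDifferentiableAt ℝ f (x + s • unitVec k) (unitVec j) :=
    ae_ae_line (hf.ae_lineDifferentiableAt _) _
  obtain ⟨x₀, hx₀⟩ := (ae_ae_line (heq.and hd) (unitVec j)).exists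
  set h : ℝ → ℝ → ℝ := fun y z => f (x₀ + y • unitVec j + z • unitVec k) with hh
  have hval : ∀ q : Space, ∀ τ : ℝ,
      f (q + τ • unitVec k) = h (q j - x₀ j) (q k - x₀ k + τ) := by
    intro q τ
    simp only [hh]
    conv_lhs => rw [eq_add_shifts hij hjk hik x₀ q]
    rw [← hinv _ (-(q i - x₀ i))]
    congr 1
    module
  have hlip1 : ∀ z, LipschitzWith C fun y => h y z := by
    intro z
    have : (fun y => h y z) = fun y : ℝ => f ((x₀ + z • unitVec k) + y • unitVec j) := by
      ext y
      simp only [hh]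
      congr 1
      module
    rw [this]
    exact lipschitz_line hf _ _
  have hlip2 : ∀ y, LipschitzWith C (h y) := fun y => lipschitz_line hf _ _
  -- Taking the increment by τ in z cancels c, which is constant along the line, and leaves the
  -- homogeneous equation with coefficient b.
  have hw := eq_zero_of_transport (w := fun y z => h y (z + τ) - h y z) (C := C + C) (D := C + C) (p := p)
    (y₀ := y₀ j - x₀ j) hp ?_ ?_ ?_ ?_ ?_ ?_ (x j - x₀ j) (x k - x₀ k)
  · have h1 := hval x τ
    have h2 := hval x 0
    simp only [zero_smul, add_zero] at h2
    linarith
  · have := hf.continuous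
    simp only [hh, Function.uncurry_def]
    fun_prop
  · exact fun z => (hlip1 (z + τ)).sub (hlip1 z)
  · intro y
    refine LipschitzWith.sub ?_ (hlip2 y)
    have h1 := (hlip2 y).comp (LipschitzWith.id.add (LipschitzWith.const τ))
    rw [add_zero, mul_one] at h1
    exact h1
  · intro y z
    have : ∀ z, h y (z + p) = h y z := by
      intro z
      simp only [hh]
      rw [add_smul, ← add_assoc, hper]
    simp only [add_right_comm z p τ, this]
  · filter_upwards [hx₀] with y hy
    obtain ⟨⟨b, c, hbc⟩, hdy⟩ := hy
    have hshift : ∀ {Q : ℝ → Prop}, (∀ᵐ s, Q s) → ∀ᵐ s, Q (s + τ) := fun hQ =>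
      (measurePreserving_add_right volume τ).quasiMeasurePreserving.ae hQ
    have hyd : ∀ z, LineDifferentiableAt ℝ f (x₀ + y • unitVec j + z • unitVec k) (unitVec j) →
        HasDerivAt (fun y' => h y' z)
          (lineDeriv ℝ f (x₀ + y • unitVec j + z • unitVec k) (unitVec j)) y := by
      intro z hz
      have e : ∀ y' : ℝ, x₀ + y' • unitVec j + z • unitVec k =
          (x₀ + z • unitVec k) + y' • unitVec j := fun y' => by module
      simp only [hh, e] at hz ⊢
      exact hasDerivAt_line hz
    have hzd : ∀ z, deriv (h y) z = lineDeriv ℝ f (x₀ + y • unitVec j + z • unitVec k) (unitVec k) :=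
      fun z => deriv_line _ _ _ _
    refine ⟨b, ?_⟩
    filter_upwards [hbc, hshift hbc, hdy, hshift hdy, (hlip2 y).ae_differentiableAt_real,
      hshift (hlip2 y).ae_differentiableAt_real] with z h1 h2 h3 h4 h5 h6
    have e1 := ((hyd _ h4).sub (hyd _ h3)).deriv
    have e2 := ((h6.hasDerivAt.comp_add_const z τ).sub h5.hasDerivAt).deriv
    rw [hzd, hzd] at e2
    refine e1.trans ?_
    rw [h1, h2]
    refine Eq.trans ?_ (congrArg (b * ·) e2.symm)
    ring
  · intro z
    have h1 := hval y₀ (z - (y₀ k - x₀ k) + τ)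
    have h2 := hval y₀ (z - (y₀ k - x₀ k))
    rw [hy₀] at h1 h2
    have e1 : y₀ k - x₀ k + (z - (y₀ k - x₀ k) + τ) = z + τ := by ring
    have e2 : y₀ k - x₀ k + (z - (y₀ k - x₀ k)) = z := by ring
    rw [e1] at h1
    rw [e2] at h2
    linarith

/-! ### Which components of a periodic potential depend on which coordinates. -/

section Potential

/-- The strain `mᵢⱼ + ∂ⱼ φᵢ + ∂ᵢ φⱼ` of the displacement with components `φᵢ`. -/
noncomputable def potentialStrain (φ : Fin 3 → Space → ℝ) (m : Fin 3 → Fin 3 → ℝ) (i j : Fin 3)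
    (x : Space) : ℝ :=
  m i j + lineDeriv ℝ (φ i) x (unitVec j) + lineDeriv ℝ (φ j) x (unitVec i)

/-- `φ` is a periodic Lipschitz displacement with `∂ᵢ φᵢ = 0` whose off-diagonal strains, up to
the additive constants `m`, are signs satisfying `e₁₂ e₂₃ = e₁₃`. -/
structure IsPeriodicPotential (ℓ : Fin 3 → ℝ) (φ : Fin 3 → Space → ℝ)
    (m : Fin 3 → Fin 3 → ℝ) : Prop where
  pos : ∀ i, 0 < ℓ i
  lip : ∃ C : ℝ≥0, ∀ i, LipschitzWith C (φ i)
  inv : ∀ i x (s : ℝ), φ i (x + s • unitVec i) = φ i x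
  per : ∀ i j x, φ i (x + ℓ j • unitVec j) = φ i x
  symm : ∀ i j, m i j = m j i
  sign : ∀ i j, i ≠ j → ∀ᵐ x, potentialStrain φ m i j x = 1 ∨ potentialStrain φ m i j x = -1
  prod : ∀ i j k, i ≠ j → j ≠ k → i ≠ k → ∀ᵐ x,
    potentialStrain φ m i j x * potentialStrain φ m j k x = potentialStrain φ m i k x

/-- `φᵢ` is constant on the line through `x` in direction `eⱼ`. -/
def ConstLine (φ : Fin 3 → Space → ℝ) (i j : Fin 3) (x : Space) : Prop :=
  ∀ s : ℝ, φ i (x + s • unitVec j) = φ i x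

variable {ℓ : Fin 3 → ℝ} {φ : Fin 3 → Space → ℝ} {m : Fin 3 → Fin 3 → ℝ}

theorem constLine_iff_line {i j : Fin 3} {x : Space} :
    ConstLine φ i j x ↔ ∀ a b : ℝ, φ i (x + a • unitVec j) = φ i (x + b • unitVec j) := by
  refine ⟨fun h a b => (h a).trans (h b).symm, fun h s => ?_⟩
  simpa using h s 0

theorem constLine_shift_self {i j : Fin 3} {x : Space} (s : ℝ) :
    ConstLine φ i j (x + s • unitVec j) ↔ ConstLine φ i j x := by
  simp only [constLine_iff_line, add_assoc, ← add_smul]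
  refine ⟨fun h a b => ?_, fun h a b => h _ _⟩
  simpa using h (a - s) (b - s)

theorem potentialStrain_symm (hφ : IsPeriodicPotential ℓ φ m) (i j : Fin 3) (x : Space) :
    potentialStrain φ m i j x = potentialStrain φ m j i x := by
  unfold potentialStrain
  rw [hφ.symm i j]
  ring

theorem lineDeriv_of_constLine {i j : Fin 3} (h : ∀ x, ConstLine φ i j x) (x : Space) :
    lineDeriv ℝ (φ i) x (unitVec j) = 0 :=
  lineDeriv_eq_zero (h x)

theorem lineDeriv_shift_of_constLine {i j : Fin 3} (h : ∀ x, ConstLine φ i j x) (x v : Space)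
    (s : ℝ) : lineDeriv ℝ (φ i) (x + s • unitVec j) v = lineDeriv ℝ (φ i) x v :=
  lineDeriv_shift (fun x => h x s) x v

namespace IsPeriodicPotential

variable (hφ : IsPeriodicPotential ℓ φ m)
include hφ

theorem continuous (i : Fin 3) : Continuous (φ i) := by
  obtain ⟨C, hC⟩ := hφ.lip
  exact (hC i).continuous

theorem measurable_potentialStrain (i j : Fin 3) : Measurable (potentialStrain φ m i j) :=
  ((measurable_lineDeriv (hφ.continuous i)).const_add _).add (measurable_lineDeriv (hφ.continuous j))

theorem periodic_line (i j : Fin 3) (x : Space) :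
    Function.Periodic (fun s : ℝ => φ i (x + s • unitVec j)) (ℓ j) := by
  intro s
  simp only
  rw [add_smul, ← add_assoc, hφ.per]

/-- Together with `constLine_shift_self`, this makes constancy of φ_i along e_j a condition on the
third coordinate alone. -/
theorem constLine_shift {i j : Fin 3} {x : Space} (s : ℝ) :
    ConstLine φ i j (x + s • unitVec i) ↔ ConstLine φ i j x := by
  unfold ConstLine
  simp only [add_right_comm x (s • unitVec i), hφ.inv]

theorem isClosed_constLine (i j : Fin 3) : IsClosed {x | ConstLine φ i j x} := by
  have h := hφ.continuous i
  simp only [ConstLine, ofPred_forall]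
  exact isClosed_iInter fun s => isClosed_eq (by fun_prop) h

theorem constLine_of_ae {i j : Fin 3} (h : ∀ᵐ x, ConstLine φ i j x) (x : Space) :
    ConstLine φ i j x :=
  forall_of_ae_of_isClosed (hφ.isClosed_constLine i j) h x

theorem lineDeriv_inv (i : Fin 3) (x v : Space) (s : ℝ) :
    lineDeriv ℝ (φ i) (x + s • unitVec i) v = lineDeriv ℝ (φ i) x v :=
  lineDeriv_shift (fun x => hφ.inv i x s) x v

theorem ae_sign_plane {i j : Fin 3} (hij : i ≠ j) :
    ∀ᵐ x, ∀ᵐ t : ℝ, ∀ᵐ s : ℝ,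
      m i j + deriv (fun s : ℝ => φ i (x + s • unitVec j)) s
        + deriv (fun t : ℝ => φ j (x + t • unitVec i)) t = 1 ∨
      m i j + deriv (fun s : ℝ => φ i (x + s • unitVec j)) s
        + deriv (fun t : ℝ => φ j (x + t • unitVec i)) t = -1 := by
  filter_upwards [ae_ae_line (ae_ae_line (hφ.sign i j hij) (unitVec j)) (unitVec i)] with x hx
  filter_upwards [hx] with t ht
  filter_upwards [ht] with s hs
  simp only [deriv_line]
  unfold potentialStrain at hs
  rw [hφ.lineDeriv_inv j, add_right_comm x, hφ.lineDeriv_inv i] at hs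
  exact hs

theorem ae_constLine_or_constLine {i j : Fin 3} (hij : i ≠ j) :
    ∀ᵐ x, ConstLine φ i j x ∨ ConstLine φ j i x := by
  obtain ⟨C, hC⟩ := hφ.lip
  filter_upwards [hφ.ae_sign_plane hij] with x hx
  simp only [constLine_iff_line]
  exact const_or_const (hφ.pos j) (hφ.pos i) (lipschitz_line (hC i) x j)
    (lipschitz_line (hC j) x i) (hφ.periodic_line i j x) (hφ.periodic_line j i x) hx

theorem ae_constLine_or_ne_zero {i j : Fin 3} (hij : i ≠ j) :
    ∀ᵐ x, ConstLine φ i j x ∨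
      ∀ᵐ s : ℝ, lineDeriv ℝ (φ i) (x + s • unitVec j) (unitVec j) ≠ 0 := by
  obtain ⟨C, hC⟩ := hφ.lip
  filter_upwards [hφ.ae_sign_plane hij] with x hx
  simp only [constLine_iff_line, ← deriv_line]
  exact const_or_deriv_ne_zero (hφ.pos j) (hφ.pos i) (lipschitz_line (hC i) x j)
    (lipschitz_line (hC j) x i) (hφ.periodic_line i j x) (hφ.periodic_line j i x) hx

/-- Modulo x_i, which φ_i ignores, a line in direction e_j meets every line in direction e_k. -/
theorem eq_of_constLine {i j k : Fin 3} (hij : i ≠ j) (hjk : j ≠ k) (hik : i ≠ k) {x y : Space}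
    (hx : ConstLine φ i j x) (hy : ConstLine φ i k y) : φ i x = φ i y := by
  have h := eq_add_shifts hij hjk hik x y
  have h1 : y + (-(y k - x k)) • unitVec k =
      x + (y j - x j) • unitVec j + (y i - x i) • unitVec i := by
    nth_rewrite 1 [h]
    module
  rw [← hy (-(y k - x k)), h1, hφ.inv, hx]

theorem ae_not_constLine_of_line {i j k : Fin 3} (hij : i ≠ j) (hjk : j ≠ k) (hik : i ≠ k)
    {x : Space} (h : ∀ᵐ s : ℝ, ¬ ConstLine φ i j (x + s • unitVec k)) :
    ∀ᵐ y, ¬ ConstLine φ i j y := by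
  have h1 : ∀ y : Space, ∀ᵐ s : ℝ, y + s • unitVec k ∈ {z | ConstLine φ i j z}ᶜ := by
    intro y
    filter_upwards [(measurePreserving_add_right volume (y k - x k)).quasiMeasurePreserving.ae h]
      with s hs hy
    refine hs ?_
    simp only [mem_ofPred_eq] at hy
    rw [eq_add_shifts hij hjk hik x y] at hy
    rw [← constLine_shift_self (y j - x j), ← hφ.constLine_shift (y i - x i)]
    convert hy using 1
    module
  have h2 : ∀ᵐ s : ℝ, ∀ᵐ y : Space, y + s • unitVec k ∈ {z | ConstLine φ i j z}ᶜ := by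
    rw [← Measure.ae_ae_comm]
    · exact Eventually.of_forall h1
    · exact (by fun_prop : Measurable fun q : Space × ℝ => q.1 + q.2 • unitVec k)
        (hφ.isClosed_constLine i j).measurableSet.compl
  obtain ⟨s, hs⟩ := h2.exists
  have h3 := (measurePreserving_add_right volume (-(s • unitVec k))).quasiMeasurePreserving.ae hs
  filter_upwards [h3] with y hy
  simpa using hy

/-- All e_j-lines on which φ_i is constant carry one value, that of a constant e_k-line. On an
e_k-line their parameters thus lie in a level set, where ∂_k φ_i = 0 a.e. If ∂_k φ_i ≠ 0 a.e. on
that line, these parameters form a null set, against `hj`; so almost every e_k-line is constant. -/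
theorem constLine_of_not_ae_not {i j k : Fin 3} (hij : i ≠ j) (hjk : j ≠ k) (hik : i ≠ k)
    (hj : ¬ ∀ᵐ x, ¬ ConstLine φ i j x) (hk : ¬ ∀ᵐ x, ¬ ConstLine φ i k x) (x : Space) :
    ConstLine φ i k x := by
  obtain ⟨C, hC⟩ := hφ.lip
  obtain ⟨y, hy⟩ : ∃ y, ConstLine φ i k y := by
    by_contra! h
    exact hk (Eventually.of_forall h)
  refine hφ.constLine_of_ae ?_ x
  filter_upwards [hφ.ae_constLine_or_ne_zero hik] with z hz
  refine hz.resolve_right fun hne => hj (hφ.ae_not_constLine_of_line hij hjk hik (x := z) ?_)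
  have h1 := ae_deriv_eq_zero_of_level (lipschitz_line (hC i) z k)
    {s | ConstLine φ i j (z + s • unitVec k)} (k := φ i y)
    (fun s hs => hφ.eq_of_constLine hij hjk hik hs hy)
  filter_upwards [hne, h1] with s hs h2 hcl
  refine hs ?_
  rw [← deriv_line]
  exact h2 hcl

theorem trichotomy {i j k : Fin 3} (hij : i ≠ j) (hjk : j ≠ k) (hik : i ≠ k) :
    ((∀ x, ConstLine φ i j x) ∧ ∀ x, ConstLine φ i k x) ∨ (∀ᵐ x, ¬ ConstLine φ i j x) ∨
      ∀ᵐ x, ¬ ConstLine φ i k x := by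
  by_cases hj : ∀ᵐ x, ¬ ConstLine φ i j x
  · tauto
  by_cases hk : ∀ᵐ x, ¬ ConstLine φ i k x
  · tauto
  exact Or.inl ⟨hφ.constLine_of_not_ae_not hik hjk.symm hij hk hj,
    hφ.constLine_of_not_ae_not hij hjk hik hj hk⟩

theorem constLine_of_ae_not {i j : Fin 3} (hij : i ≠ j) (h : ∀ᵐ x, ¬ ConstLine φ i j x)
    (x : Space) : ConstLine φ j i x := by
  refine hφ.constLine_of_ae ?_ x
  filter_upwards [h, hφ.ae_constLine_or_constLine hij] with y h1 h2 using h2.resolve_left h1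

/-- The three components cannot depend cyclically on one coordinate each. -/
theorem not_cyclic {i j k : Fin 3} (hij : i ≠ j) (hjk : j ≠ k) (hik : i ≠ k)
    (hn : ∀ᵐ x, ¬ ConstLine φ i j x) (hji : ∀ x, ConstLine φ j i x)
    (hkj : ∀ x, ConstLine φ k j x) (hik' : ∀ x, ConstLine φ i k x) : False := by
  obtain ⟨C, hC⟩ := hφ.lip
  obtain ⟨x, hx, hnx⟩ := ((ae_ae_line ((hφ.prod i j k hij hjk hik).and (hφ.sign j k hjk))
    (unitVec j)).and hn).exists
  refine hnx (constLine_iff_line.2 ?_)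
  set b := m j k + lineDeriv ℝ (φ j) x (unitVec k) with hb
  set c := m i k + lineDeriv ℝ (φ k) x (unitVec i) with hc
  -- Along e_j both e_jk = b and e_ik = c are frozen, so e_ij = c / b is too. Then ∂_j φ_i is
  -- constant on the line, and periodicity makes φ_i constant there.
  refine const_of_deriv_ae_eq (c := c / b - m i j) (hφ.pos j) (lipschitz_line (hC i) x j)
    (hφ.periodic_line i j x) ?_
  filter_upwards [hx] with s hs
  obtain ⟨h1, h2⟩ := hs
  rw [deriv_line]
  simp only [potentialStrain, lineDeriv_of_constLine hji, lineDeriv_of_constLine hkj,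
    lineDeriv_of_constLine hik', hφ.lineDeriv_inv j, lineDeriv_shift_of_constLine hkj,
    add_zero, ← hb, ← hc] at h1 h2
  have hb0 : b ≠ 0 := by
    rintro h0
    rw [h0] at h2
    norm_num at h2
  field_simp
  linarith

/-- If `φⱼ` is constant, `φᵢ` or `φₖ` does not contribute to `eᵢₖ`. -/
theorem constLine_of_transport {i j k : Fin 3} (hij : i ≠ j) (hjk : j ≠ k) (hik : i ≠ k)
    (hji : ∀ x, ConstLine φ j i x) (hjk' : ∀ x, ConstLine φ j k x) :
    (∀ x, ConstLine φ i k x) ∨ ∀ x, ConstLine φ k i x := by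
  obtain ⟨C, hC⟩ := hφ.lip
  by_cases hex : ∃ y, ConstLine φ i k y
  · obtain ⟨y, hy⟩ := hex
    left
    refine const_line_of_transport (hφ.pos k) (hC i) hij hjk hik (hφ.inv i) (hφ.per i k) ?_ hy
    filter_upwards [ae_ae_line ((hφ.prod i j k hij hjk hik).and (hφ.sign j k hjk)) (unitVec k)]
      with x hx
    set b := m j k + lineDeriv ℝ (φ k) x (unitVec j) with hb
    set c := m i k + lineDeriv ℝ (φ k) x (unitVec i) with hc
    -- The product relation reads (m_ij + ∂_j φ_i) b = ∂_k φ_i + c with b = ±1; multiply it by b.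
    -- Both b and c are constant along e_k because φ_k ignores x_k.
    refine ⟨b, b * c - m i j, ?_⟩
    filter_upwards [hx] with s hs
    obtain ⟨h1, h2⟩ := hs
    simp only [potentialStrain, lineDeriv_of_constLine hji, lineDeriv_of_constLine hjk',
      hφ.lineDeriv_inv k, add_zero, ← hb] at h1 h2
    have hb2 : b * b = 1 := by
      rcases h2 with h2 | h2 <;> rw [h2] <;> norm_num
    have h3 : (m i j + lineDeriv ℝ (φ i) (x + s • unitVec k) (unitVec j)) * (b * b) =
        b * (lineDeriv ℝ (φ i) (x + s • unitVec k) (unitVec k) + c) := by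
      rw [hc]
      linear_combination b * h1
    rw [hb2] at h3
    linarith
  · right
    push Not at hex
    exact hφ.constLine_of_ae ((hφ.ae_constLine_or_constLine hik).mono
      fun x hx => hx.resolve_left (hex x))

theorem exists_constLine_of_ae_not {i j k : Fin 3} (hij : i ≠ j) (hjk : j ≠ k) (hik : i ≠ k)
    (hn : ∀ᵐ x, ¬ ConstLine φ i j x) :
    ∃ l, ∀ n, n ≠ l → ∀ x, ConstLine φ n l x := by
  have hcases : ∀ n : Fin 3, n = i ∨ n = j ∨ n = k := by
    clear hn
    revert i j k
    decide
  have fin : ∀ a b c : Fin 3, (∀ n, n = a ∨ n = b ∨ n = c) → (∀ x, ConstLine φ a c x) →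
      (∀ x, ConstLine φ b c x) → ∃ l, ∀ n, n ≠ l → ∀ x, ConstLine φ n l x := by
    intro a b c h ha hb
    refine ⟨c, fun n hn => ?_⟩
    rcases h n with rfl | rfl | rfl
    · exact ha
    · exact hb
    · exact absurd rfl hn
  have hji := hφ.constLine_of_ae_not hij hn
  have goal_i : (∀ x, ConstLine φ k i x) → ∃ l, ∀ n, n ≠ l → ∀ x, ConstLine φ n l x := fun h =>
    fin j k i (fun n => by have := hcases n; tauto) hji h
  have goal_k : (∀ x, ConstLine φ i k x) → (∀ x, ConstLine φ j k x) →
      ∃ l, ∀ n, n ≠ l → ∀ x, ConstLine φ n l x := fun h h' => fin i j k hcases h h'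
  obtain ⟨x₁, hx₁⟩ := hn.exists
  -- Since φ_j ignores x_i, it is constant or varies in x_k. In the latter case φ_k ignores x_j, and
  -- it either ignores x_i as well, so that l = i works, or completes a forbidden cycle.
  rcases hφ.trichotomy hij.symm hik hjk with ⟨-, hjk'⟩ | h | h
  · rcases hφ.constLine_of_transport hij hjk hik hji hjk' with h | h
    · exact goal_k h hjk'
    · exact goal_i h
  · obtain ⟨y, hy⟩ := h.exists
    exact absurd (hji y) hy
  · have hkj := hφ.constLine_of_ae_not hjk h
    rcases hφ.trichotomy hik.symm hij hjk.symm with ⟨h1, -⟩ | h1 | h1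
    · exact goal_i h1
    · exact (hφ.not_cyclic hij hjk hik hn hji hkj (hφ.constLine_of_ae_not hik.symm h1)).elim
    · obtain ⟨y, hy⟩ := h1.exists
      exact absurd (hkj y) hy

/-- Some coordinate does not enter the strain. -/
theorem exists_constLine : ∃ l, ∀ n, n ≠ l → ∀ x, ConstLine φ n l x := by
  by_cases h : ∃ i j, i ≠ j ∧ ∀ᵐ x, ¬ ConstLine φ i j x
  · obtain ⟨i, j, hij, hn⟩ := h
    obtain ⟨k, hjk, hik⟩ : ∃ k, j ≠ k ∧ i ≠ k := by
      clear hn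
      revert i j
      decide
    exact hφ.exists_constLine_of_ae_not hij hjk hik hn
  · push Not at h
    -- Here every φ_n is constant, so any index would do.
    refine ⟨0, fun n hn => ?_⟩
    obtain ⟨k, hk0, hnk⟩ : ∃ k : Fin 3, 0 ≠ k ∧ n ≠ k := by
      revert n
      decide
    rcases hφ.trichotomy hn hk0 hnk with ⟨h1, -⟩ | h1 | h1
    · exact h1
    · exact absurd h1 (h _ _ hn)
    · exact absurd h1 (h _ _ hnk)

end IsPeriodicPotential

end Potential

/-! ### Periodic decomposition of smooth displacements and its limit. -/

section Smooth

theorem lineDeriv_shift_add {f : Space → ℝ} {w : Space} {c : ℝ} (h : ∀ x, f (x + w) = f x + c)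
    (x v : Space) : lineDeriv ℝ f (x + w) v = lineDeriv ℝ f x v := by
  unfold lineDeriv
  simp only [add_right_comm x w, h, deriv_add_const]

theorem shift_of_lineDeriv_eq {f : Space → ℝ} (hf : Differentiable ℝ f) {x v : Space} {c : ℝ}
    (h : ∀ s : ℝ, lineDeriv ℝ f (x + s • v) v = c) (s : ℝ) : f (x + s • v) = f x + s * c := by
  have h1 : ∀ t : ℝ, HasDerivAt (fun t : ℝ => f (x + t • v) - t * c) (c - 1 * c) t := by
    intro t
    rw [← h t]
    refine (hasDerivAt_line (hf _).lineDifferentiableAt).sub ?_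
    rw [h t]
    exact (hasDerivAt_id t).mul_const c
  have h2 := is_const_of_deriv_eq_zero (fun t => (h1 t).differentiableAt)
    (fun t => by rw [(h1 t).deriv]; ring) s 0
  simp only [zero_smul, add_zero, zero_mul, sub_zero] at h2
  linarith

theorem const_of_lineDeriv_zero {f : Space → ℝ} (hf : Differentiable ℝ f)
    (h : ∀ x j, lineDeriv ℝ f x (unitVec j) = 0) (x y : Space) : f y = f x := by
  rw [eq_add_shifts (i := 0) (j := 1) (k := 2) (by decide) (by decide) (by decide) x y]
  have h1 : ∀ x j (s : ℝ), f (x + s • unitVec j) = f x := fun x j s => by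
    rw [shift_of_lineDeriv_eq hf (fun s => h _ j), mul_zero, add_zero]
  rw [h1, h1, h1]

/-- The linear function with coefficients `cᵢⱼ`. -/
noncomputable def linPart (c : Fin 3 → Fin 3 → ℝ) (i : Fin 3) (x : Space) : ℝ := ∑ j, c i j * x j

theorem linPart_shift (c : Fin 3 → Fin 3 → ℝ) (i j : Fin 3) (x : Space) (s : ℝ) :
    linPart c i (x + s • unitVec j) = linPart c i x + s * c i j := by
  simp only [linPart, Pi.add_apply, Pi.smul_apply, smul_eq_mul, mul_add, Finset.sum_add_distrib]
  congr 1
  rw [Finset.sum_eq_single j]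
  · simp [unitVec, mul_comm]
  · intro b _ hb
    simp [unitVec, hb]
  · simp

theorem differentiable_linPart (c : Fin 3 → Fin 3 → ℝ) (i : Fin 3) :
    Differentiable ℝ (linPart c i) := by
  unfold linPart
  fun_prop

theorem lineDeriv_linPart (c : Fin 3 → Fin 3 → ℝ) (i j : Fin 3) (x : Space) :
    HasLineDerivAt ℝ (linPart c i) (c i j) x (unitVec j) := by
  unfold HasLineDerivAt
  simp only [linPart_shift]
  exact (hasDerivAt_mul_const (c i j)).const_add _

theorem lipschitz_of_lineDeriv_le {f : Space → ℝ} (hf : Differentiable ℝ f) {K : ℝ≥0}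
    (h : ∀ x j, |lineDeriv ℝ f x (unitVec j)| ≤ K) : LipschitzWith (3 * K) f := by
  refine lipschitzWith_of_nnnorm_fderiv_le hf fun x => ?_
  rw [← NNReal.coe_le_coe, coe_nnnorm]
  refine ContinuousLinearMap.opNorm_le_bound _ (by positivity) fun z => ?_
  have hz : z = ∑ j, z j • unitVec j := by
    ext l
    simp [Finset.sum_apply, unitVec, Pi.single_apply]
  conv_lhs => rw [hz]
  rw [map_sum]
  refine (norm_sum_le _ _).trans ?_
  have : ∀ j ∈ (Finset.univ : Finset (Fin 3)), ‖fderiv ℝ f x (z j • unitVec j)‖ ≤ K * ‖z‖ := by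
    intro j _
    rw [map_smul, norm_smul, mul_comm, ← (hf x).lineDeriv_eq_fderiv]
    exact mul_le_mul (h x j) (norm_le_pi_norm z j) (norm_nonneg _) K.2
  refine (Finset.sum_le_sum this).trans (le_of_eq ?_)
  simp
  ring

/-- A smooth displacement with periodic bounded strain and constant diagonal strain is, up to a
linear map, periodic and Lipschitz, with `vᵢ` independent of `xᵢ`. -/
theorem exists_periodic_part {ℓ d : Fin 3 → ℝ} (hℓ : ∀ i, 0 < ℓ i) {v : Fin 3 → Space → ℝ}
    (hv : ∀ i, Differentiable ℝ (v i))
    (hdiag : ∀ i x, lineDeriv ℝ (v i) x (unitVec i) = d i)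
    (hper : ∀ i j, i ≠ j → ∀ k x,
      lineDeriv ℝ (v i) (x + ℓ k • unitVec k) (unitVec j) +
        lineDeriv ℝ (v j) (x + ℓ k • unitVec k) (unitVec i) =
      lineDeriv ℝ (v i) x (unitVec j) + lineDeriv ℝ (v j) x (unitVec i))
    (hbd : ∀ i j, i ≠ j → ∀ x,
      |lineDeriv ℝ (v i) x (unitVec j) + lineDeriv ℝ (v j) x (unitVec i)| ≤ 1) :
    ∃ c : Fin 3 → Fin 3 → ℝ, ∀ i,
      (∀ x (s : ℝ), v i (x + s • unitVec i) - linPart c i (x + s • unitVec i) =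
        v i x - linPart c i x) ∧
      (∀ j x, v i (x + ℓ j • unitVec j) - linPart c i (x + ℓ j • unitVec j) =
        v i x - linPart c i x) ∧
      LipschitzWith (3 * 2) (fun x => v i x - linPart c i x) := by
  have hvi : ∀ i x (s : ℝ), v i (x + s • unitVec i) = v i x + s * d i := fun i x s =>
    shift_of_lineDeriv_eq (hv i) (fun s => hdiag i _) s
  have gi : ∀ i x w (s : ℝ), lineDeriv ℝ (v i) (x + s • unitVec i) w = lineDeriv ℝ (v i) x w :=
    fun i x w s => lineDeriv_shift_add (fun x => hvi i x s) x w
  -- This is the gradient of the increment of v over the k-th period. Periodicity of the strain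
  -- makes it skew in i, j; the aim is to show that it vanishes, so that the increments are
  -- constants.
  set A : Fin 3 → Fin 3 → Fin 3 → Space → ℝ := fun i j k x =>
    lineDeriv ℝ (v i) (x + ℓ k • unitVec k) (unitVec j) - lineDeriv ℝ (v i) x (unitVec j) with hA
  have hAanti : ∀ i j, i ≠ j → ∀ k x, A i j k x = - A j i k x := by
    intro i j hij k x
    have := hper i j hij k x
    simp only [hA]
    linarith
  have hAj : ∀ i j, i ≠ j → ∀ k x (s : ℝ), A i j k (x + s • unitVec j) = A i j k x := by
    intro i j hij k x s
    rw [hAanti i j hij, hAanti i j hij]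
    simp only [hA, add_right_comm x (s • unitVec j), gi]
  have hdiff : ∀ i k, Differentiable ℝ fun x => v i (x + ℓ k • unitVec k) - v i x := fun i k =>
    ((hv i).comp (by fun_prop)).sub (hv i)
  have hD : ∀ i j k x, lineDeriv ℝ (fun x => v i (x + ℓ k • unitVec k) - v i x) x (unitVec j) =
      A i j k x := by
    intro i j k x
    have h1 := ((hv i) (x + ℓ k • unitVec k)).lineDifferentiableAt (v := unitVec j)
    have h2 := ((hv i) x).lineDifferentiableAt (v := unitVec j)
    have h3 := (HasDerivAt.sub h1.hasLineDerivAt h2.hasLineDerivAt).deriv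
    refine Eq.trans ?_ h3
    unfold lineDeriv
    congr 1
    ext t
    simp only [add_right_comm x (t • unitVec j), Pi.sub_apply]
  have hS : ∀ i j, i ≠ j → ∀ k x,
      v i (x + ℓ j • unitVec j + ℓ k • unitVec k) - v i (x + ℓ j • unitVec j) =
        v i (x + ℓ k • unitVec k) - v i x + ℓ j * A i j k x := by
    intro i j hij k x
    refine shift_of_lineDeriv_eq (hdiff i k) (fun s => ?_) (ℓ j)
    rw [hD, hAj i j hij]
  -- Both sides are the mixed second difference of v_i over the periods j and k. Hence A_ijk / ℓ_k
  -- is symmetric in j, k and skew in i, j, which forces it to vanish, as in the uniqueness of the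
  -- Levi-Civita connection.
  have hAsymm : ∀ i j k, i ≠ j → i ≠ k → ∀ x, ℓ j * A i j k x = ℓ k * A i k j x := by
    intro i j k hij hik x
    have h1 := hS i j hij k x
    have h2 := hS i k hik j x
    rw [add_right_comm x] at h2
    linarith
  have hA0 : ∀ i j, i ≠ j → ∀ k x, A i j k x = 0 := by
    intro i j hij k x
    by_cases hki : k = i
    · subst hki
      simp [hA, gi]
    by_cases hkj : k = j
    · subst hkj
      rw [hAanti i k hij]
      simp [hA, gi]
    have e1 := hAsymm i j k hij (Ne.symm hki) x
    have e2 := hAsymm k i j hki hkj x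
    have e3 := hAsymm j k i (Ne.symm hkj) (Ne.symm hij) x
    have a1 := hAanti i j hij k x
    have a2 := hAanti i k (Ne.symm hki) j x
    have a3 := hAanti j k (Ne.symm hkj) i x
    have hi := hℓ i
    have hj := hℓ j
    have hk := hℓ k
    rw [a2] at e1
    rw [← neg_eq_iff_eq_neg.2 a3] at e2
    rw [← neg_eq_iff_eq_neg.2 a1] at e3
    have h2 : (ℓ i * ℓ j) * (2 * A i j k x) = 0 := by
      linear_combination ℓ i * e1 - ℓ k * e2 + ℓ j * e3
    have h3 : ℓ i * ℓ j ≠ 0 := by positivity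
    have := (mul_eq_zero.1 h2).resolve_left h3
    linarith
  have hA0' : ∀ i j k x, A i j k x = 0 := by
    intro i j k x
    by_cases hij : i = j
    · subst hij
      simp [hA, hdiag]
    · exact hA0 i j hij k x
  set c : Fin 3 → Fin 3 → ℝ := fun i j => (v i (0 + ℓ j • unitVec j) - v i 0) / ℓ j with hc
  have hvper : ∀ i j x, v i (x + ℓ j • unitVec j) = v i x + ℓ j * c i j := by
    intro i j x
    have h1 := const_of_lineDeriv_zero (hdiff i j) (fun x k => by rw [hD, hA0']) 0 x
    have h2 := (hℓ j).ne'
    simp only [hc]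
    field_simp
    linarith
  have hcd : ∀ i, c i i = d i := by
    intro i
    have h1 := hvper i i 0
    rw [hvi] at h1
    have h2 := (hℓ i).ne'
    have h3 := add_left_cancel h1
    exact (mul_left_cancel₀ h2 h3).symm
  have hwi : ∀ i x (s : ℝ), v i (x + s • unitVec i) - linPart c i (x + s • unitVec i) =
        v i x - linPart c i x := by
    intro i x s
    rw [linPart_shift, hvi, hcd]
    ring
  have hwp : ∀ i j x, v i (x + ℓ j • unitVec j) - linPart c i (x + ℓ j • unitVec j) =
        v i x - linPart c i x := by
    intro i j x
    rw [linPart_shift, hvper]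
    ring
  have hwd : ∀ i, Differentiable ℝ fun x => v i x - linPart c i x := fun i =>
    (hv i).sub (differentiable_linPart c i)
  have hP : ∀ i j x, lineDeriv ℝ (fun x => v i x - linPart c i x) x (unitVec j) =
      lineDeriv ℝ (v i) x (unitVec j) - c i j := fun i j x =>
    (HasDerivAt.sub ((hv i) x).lineDifferentiableAt.hasLineDerivAt
      (lineDeriv_linPart c i j x)).deriv
  have hrolle : ∀ i j x, ∃ s : ℝ, lineDeriv ℝ (v i) (x + s • unitVec j) (unitVec j) = c i j := by
    intro i j x
    have hcont := (hwd i).continuous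
    obtain ⟨s, -, hs⟩ := exists_deriv_eq_zero
      (f := fun s : ℝ => v i (x + s • unitVec j) - linPart c i (x + s • unitVec j)) (hℓ j)
      (Continuous.continuousOn (hcont.comp (g := fun x => v i x - linPart c i x)
        (f := fun s : ℝ => x + s • unitVec j) (by fun_prop)))
      (by rw [hwp]; simp)
    refine ⟨s, ?_⟩
    rw [deriv_line (fun x => v i x - linPart c i x), hP] at hs
    linarith
  refine ⟨c, fun i => ⟨hwi i, hwp i, lipschitz_of_lineDeriv_le (hwd i) fun x j => ?_⟩⟩
  rw [hP]
  by_cases hij : i = j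
  · subst hij
    rw [hdiag, hcd]
    simp
  -- At points supplied by Rolle, the strain bound gives |∂_j v_i(x) + c_ji| ≤ 1 and |c_ij + c_ji| ≤
  -- 1; subtracting yields the bound 2.
  obtain ⟨t, ht⟩ := hrolle j i x
  obtain ⟨s, hs⟩ := hrolle i j x
  obtain ⟨t', ht'⟩ := hrolle j i (x + s • unitVec j)
  have b1 := hbd i j hij (x + t • unitVec i)
  have b2 := hbd i j hij (x + s • unitVec j + t' • unitVec i)
  rw [ht, gi] at b1
  rw [ht', gi, hs] at b2
  rw [abs_le] at b1 b2 ⊢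
  simp only [NNReal.coe_ofNat]
  constructor <;> linarith [b1.1, b1.2, b2.1, b2.2]

/-- Passing to the limit in the decomposition of `exists_periodic_part`. -/
theorem exists_periodic_limit {ℓ : Fin 3 → ℝ} (hℓ : ∀ i, 0 < ℓ i)
    {v : ℕ → Fin 3 → Space → ℝ} {f : Fin 3 → Space → ℝ} {K : ℝ≥0}
    (hv : ∀ n, ∃ c : Fin 3 → Fin 3 → ℝ, ∀ i,
      (∀ x (s : ℝ), v n i (x + s • unitVec i) - linPart c i (x + s • unitVec i) =
        v n i x - linPart c i x) ∧
      (∀ j x, v n i (x + ℓ j • unitVec j) - linPart c i (x + ℓ j • unitVec j) =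
        v n i x - linPart c i x) ∧
      LipschitzWith K (fun x => v n i x - linPart c i x))
    (hlim : ∀ i, ∀ᵐ x, Tendsto (fun n => v n i x) atTop (𝓝 (f i x))) :
    ∃ (c : Fin 3 → Fin 3 → ℝ) (φ : Fin 3 → Space → ℝ),
      (∀ i, ∀ᵐ x, f i x = φ i x + linPart c i x) ∧
      (∀ i x (s : ℝ), φ i (x + s • unitVec i) = φ i x) ∧
      (∀ i j x, φ i (x + ℓ j • unitVec j) = φ i x) ∧
      ∀ i, LipschitzWith K (φ i) := by
  choose c hci hcp hcl using hv
  have hshift : ∀ {Q : Space → Prop} (w : Space), (∀ᵐ x, Q x) → ∀ᵐ x, Q (x + w) := fun w hQ =>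
    (measurePreserving_add_right volume w).quasiMeasurePreserving.ae hQ
  -- The coefficients are difference quotients over one period, so they converge once v n i does at
  -- x and at its translate.
  have hclim : ∀ i j, ∃ a, Tendsto (fun n => c n i j) atTop (𝓝 a) := by
    intro i j
    obtain ⟨x, hx, hx'⟩ := ((hlim i).and (hshift (ℓ j • unitVec j) (hlim i))).exists
    refine ⟨(f i (x + ℓ j • unitVec j) - f i x) / ℓ j,
      ((hx'.sub hx).div_const (ℓ j)).congr fun n => ?_⟩
    have h1 := hcp n i j x
    rw [linPart_shift] at h1
    have h2 := (hℓ j).ne'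
    field_simp
    linarith
  choose a ha using hclim
  have hw : ∀ i, ∀ᵐ x, Tendsto (fun n => v n i x - linPart (c n) i x) atTop
      (𝓝 (f i x - linPart a i x)) := by
    intro i
    filter_upwards [hlim i] with x hx
    refine hx.sub ?_
    unfold linPart
    exact tendsto_finsetSum _ fun j _ => (ha i j).mul_const _
  have hext : ∀ i, ∃ φ : Space → ℝ, LipschitzWith K φ ∧ ∀ᵐ x, f i x - linPart a i x = φ x ∧
      Tendsto (fun n => v n i x - linPart (c n) i x) atTop (𝓝 (φ x)) := by
    intro i
    have hL : LipschitzOnWith K (fun x => f i x - linPart a i x)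
        {x | Tendsto (fun n => v n i x - linPart (c n) i x) atTop (𝓝 (f i x - linPart a i x))} := by
      refine LipschitzOnWith.of_dist_le_mul fun x hx y hy => ?_
      exact le_of_tendsto' (hx.dist hy) fun n => (hcl n i).dist_le_mul x y
    obtain ⟨φ, hφ, he⟩ := hL.extend_real
    refine ⟨φ, hφ, ?_⟩
    filter_upwards [hw i] with x hx
    have h1 := he hx
    simp only at h1
    exact ⟨h1, h1 ▸ hx⟩
  choose φ hφ he using hext
  -- Invariances pass to the limit only almost everywhere; continuity of φ_i extends them to all
  -- points.
  have hinv : ∀ i (w : Space), (∀ n x, v n i (x + w) - linPart (c n) i (x + w) =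
      v n i x - linPart (c n) i x) → ∀ x, φ i (x + w) = φ i x := by
    intro i w hw
    have hc := (hφ i).continuous
    refine forall_of_ae_of_isClosed (isClosed_eq (by fun_prop) hc) ?_
    filter_upwards [he i, hshift w (he i)] with x h1 h2
    refine tendsto_nhds_unique h2.2 (h1.2.congr fun n => (hw n x).symm)
  refine ⟨a, φ, fun i => (he i).mono fun x hx => by linarith [hx.1],
    fun i x s => hinv i _ (fun n x => hci n i x s) x, fun i j x => hinv i _ (fun n x => hcp n i j x) x,
    hφ⟩

end Smooth

/-! ### Mollification and weak derivatives. -/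

section Mollify

open scoped Convolution

/-- The convolution of `f` with the kernel `ρ`. -/
noncomputable def mollify (f ρ : Space → ℝ) (x : Space) : ℝ := ∫ t, f t * ρ (x - t)

variable {f g ρ : Space → ℝ}

theorem mollify_congr (h : ∀ᵐ x, f x = g x) (ρ : Space → ℝ) : mollify f ρ = mollify g ρ := by
  ext x
  refine integral_congr_ae ?_
  filter_upwards [h] with t ht
  rw [ht]

theorem mollify_shift (f ρ : Space → ℝ) (x w : Space) :
    mollify f ρ (x + w) = mollify (fun t => f (t + w)) ρ x := by
  unfold mollify
  rw [← integral_add_right_eq_self _ w]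
  simp only [add_sub_add_right_eq_sub]

theorem mollify_of_ae_invariant {w : Space} (h : ∀ᵐ x, f (x + w) = f x) (ρ : Space → ℝ) (x : Space) :
    mollify f ρ (x + w) = mollify f ρ x := by
  rw [mollify_shift, mollify_congr h]

theorem integrable_mollify (hf : LocallyIntegrable f) (hρ : Continuous ρ)
    (hc : HasCompactSupport ρ) (x : Space) : Integrable fun t => f t * ρ (x - t) :=
  hc.convolutionExists_right (ContinuousLinearMap.mul ℝ ℝ) hf hρ x

theorem mollify_add (hf : LocallyIntegrable f) (hg : LocallyIntegrable g) (hρ : Continuous ρ)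
    (hc : HasCompactSupport ρ) (x : Space) :
    mollify (fun x => f x + g x) ρ x = mollify f ρ x + mollify g ρ x := by
  unfold mollify
  rw [← integral_add (integrable_mollify hf hρ hc x) (integrable_mollify hg hρ hc x)]
  simp only [add_mul]

theorem mollify_const (c : ℝ) (h1 : ∫ x, ρ x = 1) (x : Space) : mollify (fun _ => c) ρ x = c := by
  unfold mollify
  rw [integral_const_mul, integral_sub_left_eq_self ρ volume x, h1, mul_one]

theorem abs_mollify_le {K : ℝ} (hf : ∀ᵐ x, |f x| ≤ K) (hρ : Continuous ρ)
    (hc : HasCompactSupport ρ) (h0 : ∀ x, 0 ≤ ρ x) (h1 : ∫ x, ρ x = 1) (x : Space) :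
    |mollify f ρ x| ≤ K := by
  have hi : Integrable fun t => K * ρ (x - t) :=
    integrable_mollify (f := fun _ => K) (locallyIntegrable_const K) hρ hc x
  have h2 : ‖∫ t, f t * ρ (x - t)‖ ≤ ∫ t, K * ρ (x - t) := by
    refine norm_integral_le_of_norm_le hi ?_
    filter_upwards [hf] with t ht
    rw [norm_mul, Real.norm_of_nonneg (h0 _)]
    exact mul_le_mul_of_nonneg_right ht (h0 _)
  exact h2.trans (le_of_eq (mollify_const K h1 x))

theorem hasFDerivAt_mollify (hf : LocallyIntegrable f) (hρ : ContDiff ℝ 1 ρ)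
    (hc : HasCompactSupport ρ) (x : Space) :
    ∃ D : Space →L[ℝ] ℝ, HasFDerivAt (mollify f ρ) D x ∧
      ∀ v, D v = ∫ t, f t * fderiv ℝ ρ (x - t) v := by
  refine ⟨_, hc.hasFDerivAt_convolution_right (ContinuousLinearMap.mul ℝ ℝ) hf hρ x, fun v => ?_⟩
  rw [convolution_precompR_apply _ hf (hc.fderiv ℝ) (hρ.continuous_fderiv one_ne_zero)]
  rfl

theorem differentiable_mollify (hf : LocallyIntegrable f) (hρ : ContDiff ℝ 1 ρ)
    (hc : HasCompactSupport ρ) : Differentiable ℝ (mollify f ρ) := fun x => by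
  obtain ⟨D, hD, -⟩ := hasFDerivAt_mollify hf hρ hc x
  exact hD.differentiableAt

theorem lineDeriv_mollify (hf : LocallyIntegrable f) (hρ : ContDiff ℝ 1 ρ)
    (hc : HasCompactSupport ρ) (x v : Space) :
    lineDeriv ℝ (mollify f ρ) x v = ∫ t, f t * fderiv ℝ ρ (x - t) v := by
  obtain ⟨D, hD, h⟩ := hasFDerivAt_mollify hf hρ hc x
  rw [hD.differentiableAt.lineDeriv_eq_fderiv, hD.fderiv, h]

theorem fderiv_comp_sub (hρ : ContDiff ℝ ∞ ρ) (x t v : Space) :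
    fderiv ℝ (fun t => ρ (x - t)) t v = - fderiv ℝ ρ (x - t) v := by
  have h1 : HasFDerivAt ρ (fderiv ℝ ρ (x - t)) (x - t) :=
    (hρ.differentiable (by simp) _).hasFDerivAt
  have h2 := h1.comp t ((hasFDerivAt_id t).const_sub x)
  have h3 := congrArg (fun L => L v) h2.fderiv
  simpa [Function.comp_def] using h3

theorem lineDeriv_mollify_of_hasWeakPartial {j : Fin 3} (h : HasWeakPartial j f g)
    (hρ : ContDiff ℝ ∞ ρ) (hc : HasCompactSupport ρ) (x : Space) :
    lineDeriv ℝ (mollify f ρ) x (unitVec j) = mollify g ρ x := by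
  obtain ⟨hf, -, h⟩ := h
  rw [lineDeriv_mollify hf (hρ.of_le (by simp)) hc]
  have h1 := h (fun t => ρ (x - t)) (hρ.comp (contDiff_const.sub contDiff_id))
    (hc.comp_homeomorph (Homeomorph.subLeft x))
  simp only [fderiv_comp_sub hρ, mul_neg, integral_neg, neg_inj] at h1
  exact h1

theorem exists_mollifier : ∃ ρ : ℕ → Space → ℝ, (∀ n, ContDiff ℝ ∞ (ρ n)) ∧
    (∀ n, HasCompactSupport (ρ n)) ∧ (∀ n x, 0 ≤ ρ n x) ∧ (∀ n, ∫ x, ρ n x = 1) ∧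
    ∀ f : Space → ℝ, LocallyIntegrable f →
      ∀ᵐ x, Tendsto (fun n => mollify f (ρ n) x) atTop (𝓝 (f x)) := by
  let b : ℕ → ContDiffBump (0 : Space) := fun n =>
    ⟨1 / ((n : ℝ) + 1), 2 * (1 / ((n : ℝ) + 1)), by positivity, by
      have : 0 < 1 / ((n : ℝ) + 1) := by positivity
      linarith⟩
  refine ⟨fun n => (b n).normed volume, fun n => (b n).contDiff_normed,
    fun n => (b n).hasCompactSupport_normed, fun n => (b n).nonneg_normed,
    fun n => (b n).integral_normed, fun f hf => ?_⟩
  have h1 : Tendsto (fun n => (b n).rOut) atTop (𝓝 0) := by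
    have := (tendsto_one_div_add_atTop_nhds_zero_nat (𝕜 := ℝ)).const_mul 2
    rwa [mul_zero] at this
  filter_upwards [ContDiffBump.ae_convolution_tendsto_right_of_locallyIntegrable (K := 2) h1
    (Eventually.of_forall fun n => le_rfl) hf] with x hx
  refine hx.congr fun n => ?_
  rw [convolution_lsmul_swap]
  simp only [smul_eq_mul, mollify, mul_comm]

theorem ae_invariant_of_hasWeakPartial_zero {j : Fin 3} (h : HasWeakPartial j f fun _ => 0) (s : ℝ) :
    ∀ᵐ x, f (x + s • unitVec j) = f x := by
  obtain ⟨ρ, hρ, hc, -, -, hlim⟩ := exists_mollifier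
  have h1 := hlim f h.1
  filter_upwards [h1, (measurePreserving_add_right volume
    (s • unitVec j)).quasiMeasurePreserving.ae h1] with x hx hx'
  refine tendsto_nhds_unique hx' (hx.congr fun n => ?_)
  rw [shift_of_lineDeriv_eq (c := 0) (differentiable_mollify h.1 ((hρ n).of_le (by simp)) (hc n))]
  · ring
  · intro s
    rw [lineDeriv_mollify_of_hasWeakPartial h (hρ n) (hc n)]
    simp [mollify]

/-- Up to sign, the pairing of f with ∂_j φ is the derivative at 0 of f mollified by the reflected
φ, and this mollification is invariant along e_j. -/
theorem hasWeakPartial_zero_of_ae_invariant {j : Fin 3} (hf : LocallyIntegrable f)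
    (h : ∀ s : ℝ, ∀ᵐ x, f (x + s • unitVec j) = f x) : HasWeakPartial j f fun _ => 0 := by
  refine ⟨hf, locallyIntegrable_zero, fun φ hφ hc => ?_⟩
  have hρ : ContDiff ℝ ∞ fun z => φ (0 - z) := hφ.comp (contDiff_const.sub contDiff_id)
  have hcρ : HasCompactSupport fun z => φ (0 - z) := hc.comp_homeomorph (Homeomorph.subLeft 0)
  have h1 := lineDeriv_mollify hf (hρ.of_le (by simp)) hcρ 0 (unitVec j)
  rw [lineDeriv_eq_zero fun s => mollify_of_ae_invariant (h s) _ 0] at h1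
  simp only [fderiv_comp_sub hφ, sub_sub_cancel, mul_neg, integral_neg, zero_mul, integral_zero,
    neg_zero] at h1 ⊢
  linarith

theorem HasWeakPartial.const_mul {j : Fin 3} (h : HasWeakPartial j f g) (c : ℝ) :
    HasWeakPartial j (fun x => c * f x) fun x => c * g x := by
  obtain ⟨hf, hg, h⟩ := h
  refine ⟨hf.smul c, hg.smul c, fun φ hφ hc => ?_⟩
  simp only [mul_assoc, integral_const_mul, h φ hφ hc, mul_neg]

theorem lineDeriv_ae_eq_of_hasWeakPartial {j : Fin 3} {h : Space → ℝ} {C : ℝ≥0}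
    (hw : HasWeakPartial j f g) (hL : LipschitzWith C h) (he : ∀ᵐ x, f x = h x) :
    ∀ᵐ x, lineDeriv ℝ h x (unitVec j) = g x := by
  refine ae_eq_of_integral_contDiff_smul_eq (hL.locallyIntegrable_lineDeriv _) hw.2.1
    fun φ hφ hc => ?_
  obtain ⟨D, hD⟩ := ContDiff.lipschitzWith_of_hasCompactSupport hc hφ (by simp)
  have h1 := hL.integral_lineDeriv_mul_eq (μ := volume) hD hc (unitVec j)
  have h2 := hw.2.2 φ hφ hc
  have h3 : ∫ x, f x * fderiv ℝ φ x (unitVec j) = ∫ x, h x * fderiv ℝ φ x (unitVec j) := by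
    refine integral_congr_ae ?_
    filter_upwards [he] with x hx
    rw [hx]
  simp only [(hφ.differentiable (by simp)).differentiableAt.lineDeriv_eq_fderiv, map_neg, neg_mul,
    integral_neg] at h1
  simp only [smul_eq_mul, mul_comm (φ _)]
  simp only [mul_comm (fderiv ℝ φ _ _)] at h1
  rw [h1]
  have h4 : ∫ x, f x * fderiv ℝ φ x (unitVec j) = -∫ x, g x * φ x := h2
  rw [← h3, h4, neg_neg]

end Mollify

/-! ### From the differential inclusion to a periodic potential. -/

section Existence

variable {ℓ d : Fin 3 → ℝ} {u : Space → Space} {G : Space → Matrix (Fin 3) (Fin 3) ℝ}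

theorem symGrad_apply (G : Space → Matrix (Fin 3) (Fin 3) ℝ) (x : Space) (i j : Fin 3) :
    symGrad G x i j = 1 / 2 * G x i j + 1 / 2 * G x j i := by
  simp [symGrad]
  ring

theorem diag_of_mem_wells {M : Matrix (Fin 3) (Fin 3) ℝ} (h : M ∈ wells d) (i : Fin 3) :
    M i i = d i := by
  simp only [wells, mem_insert_iff, mem_singleton_iff] at h
  rcases h with rfl | rfl | rfl | rfl <;> fin_cases i <;> rfl

theorem sign_of_mem_wells {M : Matrix (Fin 3) (Fin 3) ℝ} (h : M ∈ wells d) {i j : Fin 3}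
    (hij : i ≠ j) : M i j = 1 ∨ M i j = -1 := by
  simp only [wells, mem_insert_iff, mem_singleton_iff] at h
  rcases h with rfl | rfl | rfl | rfl <;> fin_cases i <;> fin_cases j <;> simp at hij ⊢

/-- In each well the three off-diagonal signs have product 1, a condition that does not depend on
the order of the indices. -/
theorem prod_of_mem_wells {M : Matrix (Fin 3) (Fin 3) ℝ} (h : M ∈ wells d) {i j k : Fin 3}
    (hij : i ≠ j) (hjk : j ≠ k) (hik : i ≠ k) : M i j * M j k = M i k := by
  simp only [wells, mem_insert_iff, mem_singleton_iff] at h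
  rcases h with rfl | rfl | rfl | rfl <;> fin_cases i <;> fin_cases j <;> fin_cases k <;>
    simp at hij hjk hik ⊢

theorem exists_potential (hℓ : ∀ i, 0 < ℓ i) (hG : HasWeakGradient u G)
    (hper : IsTorusPeriodic ℓ (symGrad G)) (hincl : ∀ᵐ x : Space, symGrad G x ∈ wells d) :
    ∃ (φ : Fin 3 → Space → ℝ) (m : Fin 3 → Fin 3 → ℝ), IsPeriodicPotential ℓ φ m ∧
      ∀ i j, i ≠ j → ∀ᵐ x, symGrad G x i j = potentialStrain φ m i j x := by
  obtain ⟨ρ, hρ, hc, h0, h1, hlim⟩ := exists_mollifier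
  -- Halving u absorbs the factor 1/2 of the symmetrized gradient; the diagonal derivatives then
  -- become d_i / 2.
  have hw : ∀ i j, HasWeakPartial j (fun x => 1 / 2 * u x i) (fun x => 1 / 2 * G x i j) :=
    fun i j => (hG i j).const_mul _
  have hρ1 : ∀ n, ContDiff ℝ 1 (ρ n) := fun n => (hρ n).of_le (by simp)
  have hE : ∀ n i j x,
      lineDeriv ℝ (mollify (fun x => 1 / 2 * u x i) (ρ n)) x (unitVec j) +
        lineDeriv ℝ (mollify (fun x => 1 / 2 * u x j) (ρ n)) x (unitVec i) =
      mollify (fun x => symGrad G x i j) (ρ n) x := by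
    intro n i j x
    rw [lineDeriv_mollify_of_hasWeakPartial (hw i j) (hρ n) (hc n),
      lineDeriv_mollify_of_hasWeakPartial (hw j i) (hρ n) (hc n),
      ← mollify_add (hw i j).2.1 (hw j i).2.1 (hρ n).continuous (hc n)]
    simp only [symGrad_apply]
  obtain ⟨c, φ, hφe, hφi, hφp, hφl⟩ := exists_periodic_limit (ℓ := ℓ) (K := 3 * 2) hℓ
    (v := fun n i => mollify (fun x => 1 / 2 * u x i) (ρ n)) (f := fun i x => 1 / 2 * u x i)
    (fun n => exists_periodic_part (d := fun i => 1 / 2 * d i) hℓ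
      (fun i => differentiable_mollify (hw i i).1 (hρ1 n) (hc n))
      (fun i x => by
        rw [lineDeriv_mollify_of_hasWeakPartial (hw i i) (hρ n) (hc n),
          mollify_congr (g := fun _ => 1 / 2 * d i), mollify_const _ (h1 n)]
        filter_upwards [hincl] with y hy
        have := diag_of_mem_wells hy i
        rw [symGrad_apply] at this
        linarith)
      (fun i j _ k x => by
        rw [hE, hE]
        refine mollify_of_ae_invariant ?_ _ _
        filter_upwards [hper k] with y hy
        rw [← hy]
        congr 3
        rw [unitVec, ← Pi.single_smul, smul_eq_mul, mul_one])
      (fun i j hij x => by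
        rw [hE]
        refine abs_mollify_le ?_ (hρ n).continuous (hc n) (h0 n) (h1 n) x
        filter_upwards [hincl] with y hy
        rcases sign_of_mem_wells hy hij with h | h <;> rw [h] <;> simp))
    (fun i => hlim _ (hw i i).1)
  have hD : ∀ i j, ∀ᵐ x, lineDeriv ℝ (φ i) x (unitVec j) + c i j = 1 / 2 * G x i j := by
    intro i j
    obtain ⟨K, hK⟩ : ∃ K : ℝ≥0, LipschitzWith K (linPart c i) :=
      ⟨_, lipschitz_of_lineDeriv_le (K := ∑ j, ‖c i j‖₊) (differentiable_linPart c i) fun x j => by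
        rw [(lineDeriv_linPart c i j x).lineDeriv]
        have := Finset.single_le_sum (f := fun j => ‖c i j‖₊) (fun _ _ => zero_le)
          (Finset.mem_univ j)
        exact_mod_cast this⟩
    filter_upwards [lineDeriv_ae_eq_of_hasWeakPartial (hw i j) ((hφl i).add hK) (hφe i),
      (hφl i).ae_lineDifferentiableAt (unitVec j)] with x hx hd
    rw [← hx]
    exact (HasDerivAt.add hd.hasLineDerivAt (lineDeriv_linPart c i j x)).deriv.symm
  have hS : ∀ i j, i ≠ j → ∀ᵐ x, symGrad G x i j =
      potentialStrain φ (fun i j => c i j + c j i) i j x := by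
    intro i j _
    filter_upwards [hD i j, hD j i] with x hx hx'
    rw [symGrad_apply, ← hx, ← hx', potentialStrain]
    ring
  refine ⟨φ, fun i j => c i j + c j i, ⟨hℓ, ⟨_, hφl⟩, hφi, hφp, fun i j => add_comm _ _, ?_, ?_⟩, hS⟩
  · intro i j hij
    filter_upwards [hS i j hij, hincl] with x hx hm
    rw [← hx]
    exact sign_of_mem_wells hm hij
  · intro i j k hij hjk hik
    filter_upwards [hS i j hij, hS j k hjk, hS i k hik, hincl] with x e1 e2 e3 hm
    rw [← e1, ← e2, ← e3]
    exact prod_of_mem_wells hm hij hjk hik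

end Existence

/-! ### One-variable profiles of the strain entries. -/

section Structure

variable {ℓ : Fin 3 → ℝ} {φ : Fin 3 → Space → ℝ} {m : Fin 3 → Fin 3 → ℝ}

theorem potentialStrain_shift {w : Space} (h : ∀ n x, φ n (x + w) = φ n x) (i j : Fin 3)
    (x : Space) : potentialStrain φ m i j (x + w) = potentialStrain φ m i j x := by
  unfold potentialStrain
  rw [lineDeriv_shift (h i), lineDeriv_shift (h j)]

theorem ae_line_of_ae_invariant {f : Space → ℝ} (hf : Measurable f) {v : Space}
    (h : ∀ s : ℝ, ∀ᵐ x, f (x + s • v) = f x) : ∀ᵐ x, ∀ᵐ s : ℝ, f (x + s • v) = f x := by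
  rw [Measure.ae_ae_comm]
  · exact Eventually.of_forall h
  · exact measurableSet_eq_fun
      (hf.comp (by fun_prop : Measurable fun q : Space × ℝ => q.1 + q.2 • v))
      (hf.comp measurable_fst)

theorem isSignProfile_one (p : ℝ) : IsSignProfile p fun _ => 1 :=
  ⟨measurable_const, fun _ => rfl, fun _ => by simp⟩

theorem exists_slice {i j k : Fin 3} (hij : i ≠ j) (hjk : j ≠ k) (hik : i ≠ k)
    {Q : Space → Prop} (hQ : ∀ᵐ x, Q x) :
    ∃ q : ℝ, ∀ᵐ y : ℝ, ∀ᵐ z : ℝ, Q (q • unitVec i + y • unitVec j + z • unitVec k) := by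
  obtain ⟨x, hx⟩ := (ae_ae_line (ae_ae_line hQ (unitVec k)) (unitVec j)).exists
  refine ⟨x i, ?_⟩
  filter_upwards [(measurePreserving_add_right volume (-x j)).quasiMeasurePreserving.ae hx]
    with y hy
  filter_upwards [(measurePreserving_add_right volume (-x k)).quasiMeasurePreserving.ae hy]
    with z hz
  convert hz using 1
  rw [eq_add_shifts hij hjk hik 0 x]
  simp [unitVec, hij, hjk, hik, hij.symm, hjk.symm, hik.symm]
  module

namespace IsPeriodicPotential

theorem constLine_congr (hφ : IsPeriodicPotential ℓ φ m) {i j k : Fin 3} (hij : i ≠ j)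
    (hjk : j ≠ k) (hik : i ≠ k) {x y : Space} (h : x k = y k) (hx : ConstLine φ i j x) :
    ConstLine φ i j y := by
  have h1 := eq_add_shifts hij hjk hik x y
  rw [h, sub_self, zero_smul, add_zero] at h1
  rwa [h1, constLine_shift_self, hφ.constLine_shift]

/-- Along e_j the term ∂_i φ_j is frozen, so invariance of the strain makes ∂_j φ_i constant on the
line, and periodicity does the rest. -/
theorem constLine_of_invariant (hφ : IsPeriodicPotential ℓ φ m) {i j : Fin 3}
    (h : ∀ s : ℝ, ∀ᵐ x, potentialStrain φ m i j (x + s • unitVec j) = potentialStrain φ m i j x)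
    (x : Space) : ConstLine φ i j x := by
  obtain ⟨C, hC⟩ := hφ.lip
  refine hφ.constLine_of_ae ?_ x
  filter_upwards [ae_line_of_ae_invariant (hφ.measurable_potentialStrain i j) h] with y hy
  refine constLine_iff_line.2 (const_of_deriv_ae_eq (c := lineDeriv ℝ (φ i) y (unitVec j))
    (hφ.pos j) (lipschitz_line (hC i) y j) (hφ.periodic_line i j y) ?_)
  filter_upwards [hy] with s hs
  rw [deriv_line]
  unfold potentialStrain at hs
  rw [hφ.lineDeriv_inv j] at hs
  linarith

theorem exists_signProfile (hφ : IsPeriodicPotential ℓ φ m) {i j k : Fin 3} (hij : i ≠ j)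
    (hjk : j ≠ k) (hik : i ≠ k) {s : ℝ}
    (hE : ∀ᵐ x : Space, potentialStrain φ m i j (x + (s - x k) • unitVec k) =
      potentialStrain φ m i j x)
    (hc : ∀ x : Space, ConstLine φ i j (x + (s - x k) • unitVec k)) :
    ∃ f, IsSignProfile (ℓ i) f ∧ ∀ᵐ x, potentialStrain φ m i j x = f (x i) := by
  classical
  set h : ℝ → ℝ := fun t =>
    m i j + lineDeriv ℝ (φ j) (s • unitVec k + t • unitVec i) (unitVec i) with hh
  have hm : Measurable h :=
    ((measurable_lineDeriv (hφ.continuous j)).comp (by fun_prop)).const_add _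
  -- The slice derivative is known to be a sign only almost everywhere; the truncation makes it one
  -- at every t.
  refine ⟨fun t => if h t = 1 then 1 else -1, ⟨?_, ?_, ?_⟩, ?_⟩
  · exact Measurable.ite (hm (measurableSet_singleton 1)) measurable_const measurable_const
  · intro t
    have : h (t + ℓ i) = h t := by
      simp only [hh]
      rw [add_smul, ← add_assoc, lineDeriv_shift (hφ.per j i)]
    simp only [this]
  · intro t
    by_cases ht : h t = 1 <;> simp [ht]
  · filter_upwards [hE, hφ.sign i j hij] with x hx hs
    have e1 : potentialStrain φ m i j x = h (x i) := by
      rw [← hx]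
      unfold potentialStrain
      rw [lineDeriv_eq_zero (hc x), add_zero]
      simp only [hh]
      congr 1
      have e2 : x + (s - x k) • unitVec k =
          (s • unitVec k + x i • unitVec i) + x j • unitVec j := by
        conv_lhs => rw [eq_add_shifts hij hjk hik 0 x]
        simp [unitVec, hjk.symm, hik.symm]
        module
      rw [e2, hφ.lineDeriv_inv]
    rw [e1] at hs ⊢
    rcases hs with hs | hs <;> rw [hs] <;> norm_num

theorem exists_signProfile_or (hφ : IsPeriodicPotential ℓ φ m) {i j k : Fin 3} (hij : i ≠ j)
    (hjk : j ≠ k) (hik : i ≠ k)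
    (h : ∀ s : ℝ, ∀ᵐ x, potentialStrain φ m i j (x + s • unitVec k) = potentialStrain φ m i j x) :
    ∃ f g, IsSignProfile (ℓ i) f ∧ IsSignProfile (ℓ j) g ∧
      ((∀ᵐ x, potentialStrain φ m i j x = f (x i)) ∨
        ∀ᵐ x, potentialStrain φ m i j x = g (x j)) := by
  have hmE := hφ.measurable_potentialStrain i j
  have h1 : ∀ᵐ x : Space, ∀ᵐ s : ℝ, potentialStrain φ m i j (x + (s - x k) • unitVec k) =
      potentialStrain φ m i j x := by
    filter_upwards [ae_line_of_ae_invariant hmE h] with x hx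
    exact (measurePreserving_add_right volume (-x k)).quasiMeasurePreserving.ae hx
  rw [Measure.ae_ae_comm] at h1
  swap
  · exact measurableSet_eq_fun
      (hmE.comp (by fun_prop : Measurable fun q : Space × ℝ => q.1 + (q.2 - q.1 k) • unitVec k))
      (hmE.comp measurable_fst)
  obtain ⟨x₀, hx₀⟩ := (ae_ae_line (hφ.ae_constLine_or_constLine hij) (unitVec k)).exists
  have h2 := (measurePreserving_add_right volume (-x₀ k)).quasiMeasurePreserving.ae hx₀
  -- A height s is chosen at which the slice x_k = s represents the strain at almost every x and the
  -- planar alternative holds.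
  obtain ⟨s, hs, hs'⟩ := (h1.and h2).exists
  have hk : ∀ x y : Space, (x + (s + -x k) • unitVec k) k = (y + (s - y k) • unitVec k) k := by
    intro x y
    simp [unitVec]
  rcases hs' with hc | hc
  · obtain ⟨f, hf, hf'⟩ := hφ.exists_signProfile hij hjk hik hs
      fun x => hφ.constLine_congr hij hjk hik (hk x₀ x) hc
    exact ⟨f, fun _ => 1, hf, isSignProfile_one _, Or.inl hf'⟩
  · simp only [potentialStrain_symm hφ i j] at hs ⊢
    obtain ⟨f, hf, hf'⟩ := hφ.exists_signProfile hij.symm hik hjk hs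
      fun x => hφ.constLine_congr hij.symm hik hjk (hk x₀ x) hc
    exact ⟨fun _ => 1, f, isSignProfile_one _, hf, Or.inr hf'⟩

end IsPeriodicPotential

end Structure

/-! ### The primitive and the shear. -/

section Shear

variable {p : ℝ} {f : ℝ → ℝ}

theorem IsSignProfile.norm_le (hf : IsSignProfile p f) (t : ℝ) : ‖f t‖ ≤ 1 := by
  rcases hf.2.2 t with h | h
  · rw [h]
    simp
  · rw [mem_singleton_iff.1 h]
    simp

theorem IsSignProfile.intervalIntegrable (hf : IsSignProfile p f) (a b : ℝ) :
    IntervalIntegrable f volume a b := by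
  refine (intervalIntegrable_const (c := (1 : ℝ))).mono_fun hf.1.aestronglyMeasurable ?_
  refine Eventually.of_forall fun t => ?_
  simpa using hf.norm_le t

theorem IsSignProfile.lipschitz_primitive (hf : IsSignProfile p f) :
    LipschitzWith 1 (primitive f) := by
  refine LipschitzWith.of_dist_le_mul fun s t => ?_
  rw [Real.dist_eq, primitive, primitive, intervalIntegral.integral_interval_sub_left
    (hf.intervalIntegrable _ _) (hf.intervalIntegrable _ _), Real.dist_eq]
  exact intervalIntegral.norm_integral_le_of_norm_le_const fun r _ => hf.norm_le r

theorem IsSignProfile.ae_hasDerivAt_primitive (hf : IsSignProfile p f) :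
    ∀ᵐ s, HasDerivAt (primitive f) (f s) s := by
  have hl : LocallyIntegrable f := by
    refine (locallyIntegrable_const (1 : ℝ)).mono hf.1.aestronglyMeasurable ?_
    refine Eventually.of_forall fun t => ?_
    simpa using hf.norm_le t
  filter_upwards [LocallyIntegrable.ae_hasDerivAt_integral hl] with s hs using hs 0

/-- For fixed s the shear translates t; the rest permutes coordinates. Almost-everywhere statements
in space can thus be pulled back. -/
theorem measurePreserving_liftPoint_shear {F : ℝ → ℝ} (hF : Measurable F) :
    MeasurePreserving fun q : (ℝ × ℝ) × ℝ => liftPoint (shear F q.1) q.2 := by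
  have h1 : MeasurePreserving (fun r : ℝ × ℝ => (r.1, r.2 - F r.1)) :=
    (MeasurePreserving.id volume).skew_product (g := fun s t => t - F s) (by fun_prop)
      (Eventually.of_forall fun s => (measurePreserving_sub_right volume (F s)).map_eq)
  have h2 : MeasurePreserving (shear F) := Measure.measurePreserving_swap.comp h1
  have h3 := ((volume_preserving_finTwoArrow ℝ).symm _).comp h2
  have h4 := ((volume_preserving_piFinSuccAbove (fun _ : Fin 3 => ℝ) 1).symm _).comp
    (((MeasurePreserving.id (volume : Measure ℝ)).prod h3).comp Measure.measurePreserving_swap)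
  have h5 : (fun q : (ℝ × ℝ) × ℝ => liftPoint (shear F q.1) q.2) =
      (MeasurableEquiv.piFinSuccAbove (fun _ : Fin 3 => ℝ) 1).symm ∘
        Prod.map id (MeasurableEquiv.finTwoArrow.symm ∘ shear F) ∘ Prod.swap := by
    ext q l
    fin_cases l <;> rfl
  rw [h5]
  exact h4

end Shear

/-! ### Profiles along the characteristics. -/

section Transport

variable {ℓ : Fin 3 → ℝ} {φ : Fin 3 → Space → ℝ} {m : Fin 3 → Fin 3 → ℝ}

theorem lipschitz_mul_left (c : ℝ) : LipschitzWith ‖c‖₊ fun y : ℝ => c * y :=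
  LipschitzWith.of_dist_le_mul fun x y => by
    rw [Real.dist_eq, Real.dist_eq, ← mul_sub, abs_mul]
    rfl

/-- If only `φ₂` depends on the first and third coordinate, and `e₁₃` is a profile `f(x₃)`, then
`e₁₂` is constant along the characteristics `x₁ + F(x₃) = const`, where `F' = f`. -/
theorem IsPeriodicPotential.exists_characteristic_profile (hφ : IsPeriodicPotential ℓ φ m)
    (h01 : ∀ x, ConstLine φ 0 1 x) (h21 : ∀ x, ConstLine φ 2 1 x) {f : ℝ → ℝ} {p : ℝ}
    (hf : IsSignProfile p f) (hE : ∀ᵐ x : Space, potentialStrain φ m 0 2 x = f (x 2)) :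
    ∃ g : ℝ → ℝ, ∀ x : Space, potentialStrain φ m 0 1 x = g (x 0 + primitive f (x 2)) := by
  obtain ⟨C, hC⟩ := hφ.lip
  set F := primitive f with hF
  have hFL : LipschitzWith 1 F := hf.lipschitz_primitive
  have hF0 : F 0 = 0 := by simp [hF, primitive]
  have hrel : ∀ᵐ x : Space, m 1 2 + lineDeriv ℝ (φ 1) x (unitVec 2) =
      f (x 2) * (m 0 1 + lineDeriv ℝ (φ 1) x (unitVec 0)) := by
    filter_upwards [hE, hφ.prod 1 0 2 (by decide) (by decide) (by decide)] with x h1 h2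
    rw [potentialStrain_symm hφ 1 0, h1, potentialStrain, potentialStrain,
      lineDeriv_of_constLine h01, lineDeriv_of_constLine h21] at h2
    linarith
  obtain ⟨q, hq⟩ := exists_slice (i := 1) (j := 2) (k := 0) (by decide) (by decide) (by decide)
    (hrel.and ((hC 1).ae_lineDifferentiableAt (unitVec 2)))
  set b : Space := q • unitVec 1 with hb
  set h : ℝ → ℝ := fun t => φ 1 (b + t • unitVec 0) with hh
  have hhL : LipschitzWith C h := lipschitz_line (hC 1) b 0
  set ψ : ℝ → ℝ → ℝ := fun y z => φ 1 (b + y • unitVec 2 + z • unitVec 0) with hψ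
  have hcomm : ∀ y z : ℝ, b + y • unitVec 2 + z • unitVec 0 =
      b + z • unitVec 0 + y • unitVec 2 := fun y z => add_right_comm _ _ _
  have hψy : ∀ z, LipschitzWith C fun y => ψ y z := by
    intro z
    simp only [hψ, hcomm]
    exact lipschitz_line (hC 1) _ 2
  have hψz : ∀ y, LipschitzWith C (ψ y) := fun y => lipschitz_line (hC 1) _ 0
  have hper : ∀ x : Space, φ 1 (x + ℓ 0 • unitVec 0) = φ 1 x := hφ.per 1 0
  -- The subtracted terms form the explicit solution h(z + F(y)) + m₀₁ F(y) - m₁₂ y of ∂_y ψ + m₁₂ =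
  -- f(y) (∂_z ψ + m₀₁), with the data of ψ at y = 0. The difference w solves ∂_y w = f(y) ∂_z w.
  have hw := eq_zero_of_transport
    (w := fun y z => ψ y z + m 1 2 * y - h (z + F y) - m 0 1 * F y)
    (C := C + ‖m 1 2‖₊ + C * (0 + 1) + ‖m 0 1‖₊ * 1) (D := C + 0 + C * (1 + 0) + 0)
    (p := ℓ 0) (y₀ := 0) (hφ.pos 0) ?_ ?_ ?_ ?_ ?_ ?_
  · have hψe : ∀ y z, ψ y z = h (z + F y) + (m 0 1 * F y - m 1 2 * y) := fun y z => by
      linarith [hw y z]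
    -- The identity holds at every x: both derivatives are taken of the same function up to
    -- translation and constants, so their default values at points of non-differentiability also
    -- agree.
    refine ⟨fun t => m 0 1 + deriv h t, fun x => ?_⟩
    have hx : x = b + x 2 • unitVec 2 + x 0 • unitVec 0 + (x 1 - q) • unitVec 1 := by
      conv_lhs => rw [eq_add_shifts (i := 0) (j := 1) (k := 2) (by decide) (by decide) (by decide) 0 x]
      simp only [Pi.zero_apply, hb]
      module
    rw [potentialStrain, lineDeriv_of_constLine h01, add_zero]
    congr 1
    conv_lhs => rw [hx]
    rw [hφ.lineDeriv_inv 1, ← deriv_line]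
    have h2 : (fun t : ℝ => φ 1 (b + x 2 • unitVec 2 + t • unitVec 0)) =
        fun t => h (t + F (x 2)) + (m 0 1 * F (x 2) - m 1 2 * x 2) := funext fun t => hψe _ _
    rw [h2, deriv_add_const, deriv_comp_add_const]
  · have h1 := (hC 1).continuous
    have h2 := hhL.continuous
    have h3 := hFL.continuous
    simp only [hψ, Function.uncurry_def]
    fun_prop
  · intro z
    refine (((hψy z).add (lipschitz_mul_left _)).sub ?_).sub ((lipschitz_mul_left _).comp hFL)
    exact hhL.comp ((LipschitzWith.const z).add hFL)
  · intro y
    refine (((hψz y).add (LipschitzWith.const _)).sub ?_).sub (LipschitzWith.const _)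
    exact hhL.comp (LipschitzWith.id.add (LipschitzWith.const _))
  · intro y z
    have h1 : ψ y (z + ℓ 0) = ψ y z := by
      simp only [hψ]
      rw [add_smul, ← add_assoc, hper]
    have h2 : h (z + ℓ 0 + F y) = h (z + F y) := by
      simp only [hh]
      rw [add_right_comm, add_smul _ (ℓ 0), ← add_assoc, hper]
    simp only [h1, h2]
  · filter_upwards [hq, hf.ae_hasDerivAt_primitive] with y hy hFy
    refine ⟨f y, ?_⟩
    have hhd := (measurePreserving_add_right volume (F y)).quasiMeasurePreserving.ae
      hhL.ae_differentiableAt_real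
    filter_upwards [hy, hhd, (hψz y).ae_differentiableAt_real] with z hz hhz hψd
    obtain ⟨hz1, hz2⟩ := hz
    have e0 : (b + y • unitVec 2 + z • unitVec 0) 2 = y := by simp [hb, unitVec]
    rw [e0] at hz1
    have d1 : HasDerivAt (fun y' => ψ y' z)
        (lineDeriv ℝ (φ 1) (b + y • unitVec 2 + z • unitVec 0) (unitVec 2)) y := by
      simp only [hψ, hcomm] at hz2 ⊢
      exact hasDerivAt_line hz2
    have d2 : HasDerivAt (fun y' => h (z + F y')) (deriv h (z + F y) * f y) y := by
      have hhz' : HasDerivAt h (deriv h (z + F y)) (z + F y) := hhz.hasDerivAt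
      exact HasDerivAt.comp (h := fun y' => z + F y') y hhz' (hFy.const_add z)
    have d3 := ((d1.add ((hasDerivAt_id y).const_mul (m 1 2))).sub d2).sub (hFy.const_mul (m 0 1))
    have d4 := (((hψd.hasDerivAt.add_const (m 1 2 * y)).sub
      (hhz.hasDerivAt.comp_add_const z (F y))).sub_const (m 0 1 * F y))
    have e1 : deriv (ψ y) z =
        lineDeriv ℝ (φ 1) (b + y • unitVec 2 + z • unitVec 0) (unitVec 0) := deriv_line _ _ _ _
    refine (d3.deriv.trans ?_).trans (congrArg (f y * ·) d4.deriv.symm)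
    rw [e1]
    linarith
  · intro z
    simp only [hψ, hh, hF0, zero_smul, add_zero, mul_zero, sub_self]

end Transport

/-! ### Transfer between the potential and e(u). -/

section Main

variable {ℓ d : Fin 3 → ℝ} {u : Space → Space} {G : Space → Matrix (Fin 3) (Fin 3) ℝ}
  {φ : Fin 3 → Space → ℝ} {m : Fin 3 → Fin 3 → ℝ}

theorem locallyIntegrable_symGrad (hG : HasWeakGradient u G) (i j : Fin 3) :
    LocallyIntegrable fun x => symGrad G x i j := by
  simp only [symGrad_apply]
  exact ((hG i j).const_mul _).2.1.add ((hG j i).const_mul _).2.1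

theorem partialEqZero_of_potential (hG : HasWeakGradient u G)
    (hincl : ∀ᵐ x : Space, symGrad G x ∈ wells d) (hφ : IsPeriodicPotential ℓ φ m)
    (hS : ∀ i j, i ≠ j → ∀ᵐ x, symGrad G x i j = potentialStrain φ m i j x) {l : Fin 3}
    (hl : ∀ n, n ≠ l → ∀ x, ConstLine φ n l x) : PartialEqZero l (symGrad G) := by
  intro i j
  refine hasWeakPartial_zero_of_ae_invariant (locallyIntegrable_symGrad hG i j) fun s => ?_
  have hqmp := (measurePreserving_add_right (volume : Measure Space)
    (s • unitVec l)).quasiMeasurePreserving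
  by_cases hij : i = j
  · subst hij
    filter_upwards [hincl, hqmp.ae hincl] with x h1 h2
    rw [diag_of_mem_wells h1, diag_of_mem_wells h2]
  · filter_upwards [hS i j hij, hqmp.ae (hS i j hij)] with x h1 h2
    rw [h1, h2]
    refine potentialStrain_shift (fun n x => ?_) i j x
    by_cases hn : n = l
    · subst hn
      exact hφ.inv n x s
    · exact hl n hn x s

theorem potentialStrain_ae_invariant
    (hS : ∀ i j, i ≠ j → ∀ᵐ x, symGrad G x i j = potentialStrain φ m i j x) {l : Fin 3}
    (hl : PartialEqZero l (symGrad G)) {i j : Fin 3} (hij : i ≠ j) (s : ℝ) :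
    ∀ᵐ x, potentialStrain φ m i j (x + s • unitVec l) = potentialStrain φ m i j x := by
  filter_upwards [ae_invariant_of_hasWeakPartial_zero (hl i j) s, hS i j hij,
    (measurePreserving_add_right (volume : Measure Space)
      (s • unitVec l)).quasiMeasurePreserving.ae (hS i j hij)] with x h1 h2 h3
  rw [← h2, ← h3, h1]

end Main

end CubicTrigonal

theorem theorem1 (ℓ d : Fin 3 → ℝ) (hℓ : ∀ i, 0 < ℓ i)
    (u : Space → Space) (G : Space → Matrix (Fin 3) (Fin 3) ℝ)
    (hG : HasWeakGradient u G)
    (hper : IsTorusPeriodic ℓ (symGrad G))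
    (hincl : ∀ᵐ x : Space, symGrad G x ∈ wells d) :
    -- (i)
    (∃ j : Fin 3, PartialEqZero j (symGrad G)) ∧
    -- (ii)
    (PartialEqZero 1 (symGrad G) →
      ∃ f₁ f₃ : ℝ → ℝ, IsSignProfile (ℓ 0) f₁ ∧ IsSignProfile (ℓ 2) f₃ ∧
        ((∀ᵐ x : Space, symGrad G x 0 2 = f₁ (x 0)) ∨
          (∀ᵐ x : Space, symGrad G x 0 2 = f₃ (x 2)))) ∧
    -- (iii)
    (PartialEqZero 1 (symGrad G) →
      ∀ f₃ : ℝ → ℝ, IsSignProfile (ℓ 2) f₃ →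
        (∀ᵐ x : Space, symGrad G x 0 2 = f₃ (x 2)) →
        ∃ g : ℝ → ℝ, ∀ᵐ q : (ℝ × ℝ) × ℝ,
          symGrad G (liftPoint (shear (primitive f₃) q.1) q.2) 0 1 = g q.1.2 ∧
          symGrad G (liftPoint (shear (primitive f₃) q.1) q.2) 1 2 =
            f₃ q.1.1 * g q.1.2) := by
  obtain ⟨φ, m, hφ, hS⟩ := exists_potential hℓ hG hper hincl
  refine ⟨?_, fun h1 => ?_, fun h1 f hf hf' => ?_⟩
  · obtain ⟨l, hl⟩ := hφ.exists_constLine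
    exact ⟨l, partialEqZero_of_potential hG hincl hφ hS hl⟩
  · obtain ⟨f, g, hf, hg, hfg⟩ := hφ.exists_signProfile_or (i := 0) (j := 2) (k := 1) (by decide)
      (by decide) (by decide) (potentialStrain_ae_invariant hS h1 (by decide))
    refine ⟨f, g, hf, hg, hfg.imp (fun h => ?_) fun h => ?_⟩ <;>
    · filter_upwards [h, hS 0 2 (by decide)] with x e1 e2
      rw [e2, e1]
  · have hE : ∀ᵐ x : Space, potentialStrain φ m 0 2 x = f (x 2) := by
      filter_upwards [hf', hS 0 2 (by decide)] with x e1 e2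
      rw [← e2, e1]
    obtain ⟨g, hg⟩ := hφ.exists_characteristic_profile
      (hφ.constLine_of_invariant (potentialStrain_ae_invariant hS h1 (by decide)))
      (hφ.constLine_of_invariant (potentialStrain_ae_invariant hS h1 (by decide))) hf hE
    have hR : ∀ᵐ x : Space, symGrad G x 0 1 = g (x 0 + primitive f (x 2)) ∧
        symGrad G x 1 2 = f (x 2) * g (x 0 + primitive f (x 2)) := by
      filter_upwards [hf', hS 0 1 (by decide), hincl] with x e1 e2 e3
      have e4 := prod_of_mem_wells e3 (i := 1) (j := 0) (k := 2) (by decide) (by decide) (by decide)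
      have e5 : symGrad G x 1 0 = symGrad G x 0 1 := by
        rw [symGrad_apply, symGrad_apply, add_comm]
      rw [← e4, e5, e1, e2, hg]
      exact ⟨rfl, mul_comm _ _⟩
    refine ⟨g, ?_⟩
    -- On the image of the shear, x₁ + F₃(x₃) = (t - F₃(s)) + F₃(s) = t.
    filter_upwards [(measurePreserving_liftPoint_shear
      hf.lipschitz_primitive.continuous.measurable).quasiMeasurePreserving.ae hR] with q hq
    simpa [liftPoint, shear] using hq
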